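/- Let $D\ge 2$, let $r=(r_1,\dots,r_D)$ be positive numbers with $\sum_i r_i=1$, and let $s\in\mathbb R$. Let $\Lambda_D$ be the directed graph with vertices $v_1,\dots,v_D$ and exactly one edge with any given range and source. A finite path $\eta=e_1\cdots e_n$ satisfies $s(e_i)=r(e_{i+1})$, has length $|\eta|=n$, range $r(\eta)=r(e_1)$ and source $s(\eta)=s(e_n)$; vertices are paths of length $0$, and $\circ$ is the empty path, of length $-1$. For $0\le k\le|\eta|$ let $\eta[0,k]$ be the initial segment of $\eta$ of length $k$, and let $\eta[0,-1]=\circ$. Let $\partial\mathcal B_D$ be the space of infinite paths and let $[\eta]\subseteq\partial\mathcal B_D$ be the cylinder set of those with initial segment $\eta$, so that $[\circ]=\partial\mathcal B_D$. The weight $w=w_D^r$ is defined by $w(\circ)=1$ and $w(\eta)=\prod_{i=0}^{n}r_{j_i}$ if $\eta$ passes through the vertices $v_{j_0},\dots,v_{j_n}$. Put $d_w(x,y)=w(x\wedge y)$ for $x\ne y$, where $x\wedge y$ is the longest common initial segment, and $d_w(x,x)=0$. Let $\mu=\mu_D^r$ be the probability measure on $\partial\mathcal B_D$ induced by the Dixmier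 trace: for every finite path $\gamma$ (including $\circ$), $$\mu[\gamma]=\lim_{t\downarrow s_r}\frac{\sum_{\eta\ \text{extends}\ \gamma}w(\eta)^t}{\sum_{\eta}w(\eta)^t},$$ where $s_r$ is the abscissa of convergence of the denominator $\sum_\eta w(\eta)^t$ and $\eta$ ranges over all finite paths, including $\circ$. A choice function $\tau$ assigns to each finite path $\gamma$ (including $\circ$) a pair $(\tau_+(\gamma),\tau_-(\gamma))$ of points of $[\gamma]$ with $d_w(\tau_+(\gamma),\tau_-(\gamma))=w(\gamma)$. The set of choice functions is a product over $\gamma$ and carries the product probability measure, again denoted by $\mu$, of the normalized restrictions of $\mu\times\mu$. Let $$\slashed D=\bigoplus_\gamma\frac1{w(\gamma)}\begin{pmatrix}0&1\\1&0\end{pmatrix},\qquad \pi_\tau(f)=\bigoplus_\gamma\begin{pmatrix}f(\tau_+(\gamma))&0\\0&f(\tau_-(\gamma))\end{pmatrix},$$ $$Q_s(f,g)=\frac12\int\operatorname{Tr}\bigl(|\slashed D|^{-s}[\slashed D,\pi_\tau(f)]^*[\slashed D,\pi_\tau(g)]\bigr)\,d\mu(\tau),\qquad f,g\in\operatorname{span}\{\chi_{[\gamma]}\}.$$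 Let $\Delta_s^r$ be the non-positive operator on $L^2(\partial\mathcal B_D,\mu)$ associated to the closure of this form, normalized by $\langle f,\Delta_s^r g\rangle=-Q_s(f,g)$. For a finite path $\xi\ne\circ$ put $$G_s(\xi)=\tfrac12\,w(\xi)^{2-s}\sum_{e\ne e'\in r^{-1}(s(\xi))}\mu[\xi e]\,\mu[\xi e'],\qquad G_s(\circ)=\tfrac12\sum_{v\ne v'}\mu[v]\,\mu[v'],$$ and for every finite path $\eta$ (including $\circ$) put $$\lambda_\eta^r=\sum_{k=-1}^{|\eta|-1}\frac{1}{G_s(\eta[0,k])}\bigl(\mu[\eta[0,k+1]]-\mu[\eta[0,k]]\bigr)-\frac{\mu[\eta]}{G_s(\eta)};$$ in particular $\lambda_\circ^r=-G_s(\circ)^{-1}$. For $\eta\neq\circ$ let $$E_\eta^r=\operatorname{span}\Bigl\{\frac{\chi_{[\eta e]}}{\mu[\eta e]}-\frac{\chi_{[\eta e']}}{\mu[\eta e']}\ :\ e\ne e'\ \text{edges},\ r(e)=r(e')=s(\eta)\Bigr\},\qquad E_\circ^r=\operatorname{span}\Bigl\{\frac{\chi_{[v]}}{\mu[v]}-\frac{\chi_{[v']}}{\mu[v']}\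 :\ v\ne v'\Bigr\}.$$ **Theorem.** The eigenvalues of $\Delta_s^r$ are exactly $0$ and the numbers $\lambda_\eta^r$, where $\eta$ ranges over all finite paths including $\circ$. The eigenspace of $0$ consists of the constant functions. Each $E_\eta^r$ is nonzero and consists of vectors $g$ in the domain of $\Delta_s^r$ with $\Delta_s^r g=\lambda_\eta^r g$. For every $c\ne0$ the full eigenspace $\ker(\Delta_s^r-c)$ is the closed linear span of those $E_\eta^r$ with $\lambda_\eta^r=c$. The constants and the spaces $E_\eta^r$ are pairwise orthogonal and together span a dense subspace of $L^2(\partial\mathcal B_D,\mu)$. -/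

import Mathlib

open MeasureTheory Filter Topology
open scoped ENNReal Matrix

noncomputable section

namespace CuntzLaplace

/-! ### Paths on the graph with `D` vertices and exactly one edge between any two vertices -/

/-- Finite paths, including the empty path `∘`, coded by their strings of vertices.  There is exactly
one edge for each pair (range, source) of vertices, so a path of length `n ≥ 0` is the same thing as
a list of `n + 1` vertices.  The list `[]` is the empty path `∘`, of length `-1`; `[v]` is the path
of length `0` at `v`; the edges `e` with range the last vertex of `η` correspond to their sources
`v`, and `ηe` is `η ++ [v]`.  The path `η[0,k]` is `η.take (k + 1)`. -/
abbrev FinPath (D : ℕ) : Type := List (Fin D)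

/-- Infinite paths `e₁ e₂ …`, coded by the vertices `r(e₁), s(e₁), s(e₂), …`; this space carries the
product topology (generated by the cylinder sets) and the product (= Borel) σ-algebra. -/
abbrev InfPath (D : ℕ) : Type := ℕ → Fin D

variable {D : ℕ}

/-- The cylinder set `[γ]` of the infinite paths with initial segment `γ`. -/
def cyl (γ : FinPath D) : Set (InfPath D) := {x | ∀ i : Fin γ.length, x i = γ.get i}

lemma measurableSet_cyl (γ : FinPath D) : MeasurableSet (cyl γ) := by
  have h : cyl γ = ⋂ i : Fin γ.length, (fun x : InfPath D => x i) ⁻¹' {γ.get i} := by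
    ext x; simp [cyl]
  rw [h]
  exact MeasurableSet.iInter fun i => measurable_pi_apply _ (measurableSet_singleton _)

/-- The longest common initial segment `x ∧ y` of two distinct infinite paths. -/
def meet (x y : InfPath D) : FinPath D :=
  List.ofFn fun i : Fin (PiNat.firstDiff (E := fun _ => Fin D) x y) => x i

/-- The weight `w(γ) = ∏ r_v` over the vertices `v` of `γ`, with `w(∘) = 1`. -/
def weight (r : Fin D → ℝ) (γ : FinPath D) : ℝ := (γ.map r).prod

open Classical in
/-- The ultrametric `d_w` on infinite paths. -/
def ultraDist (r : Fin D → ℝ) (x y : InfPath D) : ℝ :=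
  if x = y then 0 else weight r (meet x y)

/-! ### The measure induced by the Dixmier trace -/

/-- The zeta function `ζ(t) = ½ Tr |D|^{-t} = ∑ w(γ)^t`. -/
def zeta (r : Fin D → ℝ) (t : ℝ) : ℝ := ∑' γ : FinPath D, weight r γ ^ t

/-- The abscissa of convergence of the zeta function. -/
def abscissa (r : Fin D → ℝ) : ℝ := sInf {t : ℝ | Summable fun γ : FinPath D => weight r γ ^ t}

/-- `μ` is a Borel probability measure induced by the Dixmier trace: `μ[γ]` is the limit, as `t`
decreases to the abscissa of convergence, of `∑_{η extends γ} w(η)^t / ζ(t)`. -/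
def IsDixmierMeasure (r : Fin D → ℝ) (μ : Measure (InfPath D)) : Prop :=
  IsProbabilityMeasure μ ∧ ∀ γ : FinPath D,
    Tendsto (fun t : ℝ => (∑' η : {η : FinPath D // γ <+: η}, weight r η.1 ^ t) / zeta r t)
      (𝓝[>] (abscissa r)) (𝓝 (μ.real (cyl γ)))

open Classical in
/-- The measure induced by the Dixmier trace.  (It is unique, being determined on cylinder sets.) -/
def dixmierMeasure (r : Fin D → ℝ) : Measure (InfPath D) :=
  if h : ∃ μ, IsDixmierMeasure r μ then h.choose else 0

instance (r : Fin D → ℝ) : IsFiniteMeasure (dixmierMeasure r) := by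
  unfold dixmierMeasure
  split_ifs with h
  · have := h.choose_spec.1
    infer_instance
  · infer_instance

/-! ### Choice functions -/

/-- The possible values at `γ` of a choice function: the pairs of infinite paths in `[γ]` whose
distance is the diameter `w(γ)` of `[γ]`. -/
def choicePairs (r : Fin D → ℝ) (γ : FinPath D) : Set (InfPath D × InfPath D) :=
  {p | p.1 ∈ cyl γ ∧ p.2 ∈ cyl γ ∧ ultraDist r p.1 p.2 = weight r γ}

/-- The set of choice functions `τ = (τ₊, τ₋)`. -/
abbrev ChoiceFn (r : Fin D → ℝ) : Type := (γ : FinPath D) → choicePairs r γ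

/-- The normalization of `μ × μ` to a probability measure on the set of values at `γ`. -/
def pairMeasure (r : Fin D → ℝ) (γ : FinPath D) : Measure (choicePairs r γ) :=
  (ProbabilityTheory.cond ((dixmierMeasure r).prod (dixmierMeasure r)) (choicePairs r γ)).comap
    Subtype.val

open Classical in
/-- The probability measure induced on the set of choice functions: the product of the normalized
measures `pairMeasure r γ`. -/
def choiceMeasure (r : Fin D → ℝ) : Measure (ChoiceFn r) :=
  if h : ∀ γ, IsProbabilityMeasure (pairMeasure r γ) then
    haveI := h
    Measure.infinitePi fun γ => pairMeasure r γ
  else 0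

/-! ### The spectral triple

All operators on `ℓ²(paths) ⊗ ℂ²` that occur are direct sums of `2 × 2` blocks indexed by the finite
paths, and are given by their families of blocks. -/

/-- A direct sum of `2 × 2` blocks. -/
abbrev BlockOp (D : ℕ) : Type := FinPath D → Matrix (Fin 2) (Fin 2) ℂ

/-- The trace of a direct sum of blocks. -/
def opTrace (T : BlockOp D) : ℂ := ∑' γ, (T γ).trace

/-- The Dirac operator. -/
def dirac (r : Fin D → ℝ) : BlockOp D := fun γ => ((weight r γ)⁻¹ : ℂ) • !![0, 1; 1, 0]

/-- The power `|D|^t` of the absolute value of the Dirac operator. -/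
def absDiracPow (r : Fin D → ℝ) (t : ℝ) : BlockOp D := fun γ =>
  (((weight r γ)⁻¹ ^ t : ℝ) : ℂ) • (1 : Matrix (Fin 2) (Fin 2) ℂ)

/-- The scalar blocks `absDiracPow r 1` are indeed those of `|D|`, that is `|D|² = D* D`. -/
lemma absDirac_sq (r : Fin D → ℝ) (γ : FinPath D) :
    absDiracPow r 1 γ * absDiracPow r 1 γ = (dirac r γ)ᴴ * dirac r γ := by
  ext i j
  fin_cases i <;> fin_cases j <;>
    simp [absDiracPow, dirac, Matrix.mul_apply, Fin.sum_univ_two]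

/-- The representation `π_τ` of functions. -/
def rep {r : Fin D → ℝ} (τ : ChoiceFn r) (f : InfPath D → ℂ) : BlockOp D := fun γ =>
  !![f (τ γ).1.1, 0; 0, f (τ γ).1.2]

/-- The commutator `[D, π_τ(f)]`. -/
def comm {r : Fin D → ℝ} (τ : ChoiceFn r) (f : InfPath D → ℂ) : BlockOp D := fun γ =>
  dirac r γ * rep τ f γ - rep τ f γ * dirac r γ

/-- The form `Q_s(f, g) = ½ ∫ Tr(|D|^{-s} [D, π_τ(f)]* [D, π_τ(g)]) dμ(τ)`. -/
def formQ (r : Fin D → ℝ) (s : ℝ) (f g : InfPath D → ℂ) : ℂ :=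
  (1 / 2 : ℂ) * ∫ τ : ChoiceFn r,
    opTrace (fun γ => absDiracPow r (-s) γ * ((comm τ f γ)ᴴ * comm τ g γ)) ∂(choiceMeasure r)

/-! ### The Laplace–Beltrami operator -/

/-- The domain of `Q_s`: the span of the characteristic functions of the cylinder sets. -/
def cylSpan (D : ℕ) : Submodule ℂ (InfPath D → ℂ) :=
  Submodule.span ℂ (Set.range fun γ : FinPath D => (cyl γ).indicator fun _ => (1 : ℂ))

/-- The Hilbert space `L²(μ)`. -/
abbrev L2 (r : Fin D → ℝ) : Type := Lp ℂ 2 (dixmierMeasure r)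

lemma memLp_of_mem_cylSpan (r : Fin D → ℝ) {f : InfPath D → ℂ} (hf : f ∈ cylSpan D) :
    MemLp f 2 (dixmierMeasure r) := by
  induction hf using Submodule.span_induction with
  | mem x h =>
    obtain ⟨γ, rfl⟩ := h
    exact (memLp_const (1 : ℂ)).indicator (measurableSet_cyl γ)
  | zero => exact MemLp.zero
  | add x y _ _ hx hy => exact hx.add hy
  | smul a x _ hx => exact hx.const_smul a

/-- The class in `L²(μ)` of a function in the domain of `Q_s`. -/
def toL2 (r : Fin D → ℝ) (f : cylSpan D) : L2 r := (memLp_of_mem_cylSpan r f.2).toLp f.1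

/-- The characteristic function `χ_[γ]` in `L²(μ)`; `χ_[∘]` is the constant function `1`. -/
def chi (r : Fin D → ℝ) (γ : FinPath D) : L2 r :=
  toL2 r ⟨(cyl γ).indicator fun _ => (1 : ℂ), Submodule.subset_span ⟨γ, rfl⟩⟩

/-- `g` lies in the domain of the closure of the form `Q_s`, and `⟨f, h⟩ = - Q_s(f, g)` for all `f`
in the (form-dense) domain of `Q_s`, where the value of the closure at `(f, g)` is the limit of
`Q_s(f, gₙ)` for a `Q_s`-Cauchy sequence `gₙ → g`. -/
def LaplaceRel (r : Fin D → ℝ) (s : ℝ) (g h : L2 r) : Prop :=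
  ∃ φ : ℕ → cylSpan D,
    Tendsto (fun n => toL2 r (φ n)) atTop (𝓝 g) ∧
    Tendsto (fun p : ℕ × ℕ => formQ r s (φ p.1 - φ p.2 : cylSpan D) (φ p.1 - φ p.2 : cylSpan D))
      atTop (𝓝 0) ∧
    ∀ f : cylSpan D, Tendsto (fun n => formQ r s f (φ n)) atTop (𝓝 (-inner ℂ (toL2 r f) h))

open Classical in
/-- The Laplace–Beltrami operator: the unbounded operator on `L²(μ)` associated to the closure of the
form `-Q_s`, that is, the (necessarily unique) operator whose graph is given by `LaplaceRel`.  With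
this sign it is non-positive. -/
def laplaceBeltrami (r : Fin D → ℝ) (s : ℝ) : L2 r →ₗ.[ℂ] L2 r :=
  if h : ∃ T : L2 r →ₗ.[ℂ] L2 r, ∀ g h : L2 r, (g, h) ∈ T.graph ↔ LaplaceRel r s g h then
    h.choose
  else 0

/-- The eigenspace `{g ∈ dom T : T g = c g}` of an unbounded operator. -/
def opEigenspace {H : Type*} [AddCommGroup H] [Module ℂ H] (T : H →ₗ.[ℂ] H) (c : ℂ) :
    Submodule ℂ H :=
  T.graph.comap (LinearMap.prod LinearMap.id (c • LinearMap.id))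

lemma mem_opEigenspace {H : Type*} [AddCommGroup H] [Module ℂ H] (T : H →ₗ.[ℂ] H) (c : ℂ) (g : H) :
    g ∈ opEigenspace T c ↔ ∃ hg : g ∈ T.domain, T ⟨g, hg⟩ = c • g := by
  simp only [opEigenspace, Submodule.mem_comap, LinearPMap.mem_graph_iff]
  constructor
  · rintro ⟨⟨y, hy⟩, rfl, h⟩
    exact ⟨hy, h⟩
  · rintro ⟨hg, h⟩
    exact ⟨⟨g, hg⟩, rfl, h⟩

/-! ### The spectral data -/

/-- `G_s(ξ) = ½ w(ξ)^{2-s} ∑_{e ≠ e'} μ[ξe] μ[ξe']`. -/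
def G (r : Fin D → ℝ) (s : ℝ) (ξ : FinPath D) : ℝ :=
  (1 / 2) * weight r ξ ^ (2 - s) *
    ∑ v : Fin D, ∑ v' ∈ Finset.univ.erase v,
      (dixmierMeasure r).real (cyl (ξ ++ [v])) * (dixmierMeasure r).real (cyl (ξ ++ [v']))

/-- `λ_η = ∑_{k=-1}^{|η|-1} (μ[η[0,k+1]] - μ[η[0,k]]) / G_s(η[0,k]) - μ[η] / G_s(η)`, where the index
below is `j = k + 1` and `|η| = η.length - 1`. -/
def eigval (r : Fin D → ℝ) (s : ℝ) (η : FinPath D) : ℝ :=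
  (∑ j ∈ Finset.range η.length,
    1 / G r s (η.take j) *
      ((dixmierMeasure r).real (cyl (η.take (j + 1))) - (dixmierMeasure r).real (cyl (η.take j))))
    - (dixmierMeasure r).real (cyl η) / G r s η

/-- `E_η`, the span of the functions `χ_[ηe] / μ[ηe] - χ_[ηe'] / μ[ηe']` for `e ≠ e'`. -/
def E (r : Fin D → ℝ) (η : FinPath D) : Submodule ℂ (L2 r) :=
  Submodule.span ℂ {g | ∃ v v' : Fin D, v ≠ v' ∧
    g = (((dixmierMeasure r).real (cyl (η ++ [v])))⁻¹ : ℂ) • chi r (η ++ [v])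
      - (((dixmierMeasure r).real (cyl (η ++ [v'])))⁻¹ : ℂ) • chi r (η ++ [v'])}

end CuntzLaplace

end

/-! Since there is one edge for each pair of vertices, finite paths are words in the vertices and
`w` is multiplicative under concatenation. Hence `ζ(t) = ∑_n (∑_i r_i^t)^n` has abscissa `1`, the
paths extending `γ` contribute `w(γ)^t ζ(t)`, and `μ[γ] = w(γ)` (`measureReal_cyl`): the measure is
Bernoulli with marginal `r`.

Taking the block traces and integrating over `τ` gives `Q_s(f,g) = ∑_γ (2 G_s(γ))⁻¹ ∫ conj(f x - f
y) (g x - g y)`, the integral being over the pairs that split exactly at `γ`, that is over `[γ]²`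
minus the squares `[γv]²` (`formQ_eq_sum`, `setIntegral_choicePairs`). Let `g` be supported in
`[η]`, depend there on the next vertex only and have mean zero. The integral over `[γ]²` is then `2
w(γ) ⟨f,g⟩` if `γ` is a prefix of `η`, and `0` otherwise because `g` is constant on `[γ]`. Adding up
along the prefixes yields `Q_s(f,g) = -λ_η ⟨f,g⟩` (`formQ_eq_eigval`), so the form is diagonal on
the `E_η`.

These Haar-type spaces and the constants are mutually orthogonal and span all cylinder functions,
hence a dense subspace. A form diagonal along such a decomposition has as closure the maximal
diagonal operator (`closedForm_iff_diagonal`), whose eigenspaces are the closed spans of the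
summands with equal scalar (`opEigenspace_eq_topologicalClosure`). Since every `λ_η` is negative,
only the constants belong to `0`. -/

noncomputable section

namespace CuntzLaplace

/-! ### Operators that are diagonal along an orthogonal decomposition -/

section Diagonal

variable {H : Type*} [NormedAddCommGroup H] [InnerProductSpace ℂ H] {ι : Type*}

/-- In a dense orthogonal decomposition, the orthogonal complement of a part of the summands is
the closed span of the others. -/
theorem orthogonal_iSup_eq_topologicalClosure [CompleteSpace H] (V : ι → Submodule ℂ H)
    (hV : ∀ i j, i ≠ j → V i ⟂ V j) (hd : (⨆ i, V i).topologicalClosure = ⊤) (p : ι → Prop) :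
    (⨆ i : {i // ¬ p i}, V i)ᗮ = (⨆ i : {i // p i}, V i).topologicalClosure := by
  have hle : (⨆ i : {i // p i}, V i).topologicalClosure ≤ (⨆ i : {i // ¬ p i}, V i)ᗮ := by
    refine Submodule.topologicalClosure_minimal _ (iSup_le fun i => ?_)
      (Submodule.isClosed_orthogonal _)
    have h : (⨆ j : {i // ¬ p i}, V j) ≤ (V i)ᗮ :=
      iSup_le fun j => hV j i fun h => j.2 (h ▸ i.2)
    exact (Submodule.isOrtho_iff_le.2 h).symm.le
  refine le_antisymm (fun g hg => ?_) hle
  set K := (⨆ i : {i // p i}, V i).topologicalClosure with hK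
  have : CompleteSpace K := (Submodule.isClosed_topologicalClosure _).completeSpace_coe
  have hu1 : g - K.starProjection g ∈ Kᗮ := Submodule.sub_starProjection_mem_orthogonal g
  have hu2 : g - K.starProjection g ∈ (⨆ i : {i // ¬ p i}, V i)ᗮ :=
    Submodule.sub_mem _ hg (hle (Submodule.starProjection_apply_mem K g))
  -- The residue is orthogonal to the summands in `K` as a residue, and to the others because `g`
  -- and its projection both are; density then makes it zero.
  have hu : g - K.starProjection g ∈ (⨆ i, V i)ᗮ := by
    rw [← Submodule.iInf_orthogonal, Submodule.mem_iInf] at hu2 ⊢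
    intro i
    by_cases hi : p i
    · exact Submodule.orthogonal_le ((le_iSup (fun i : {i // p i} => V i) ⟨i, hi⟩).trans
        (Submodule.le_topologicalClosure _)) hu1
    · exact hu2 ⟨i, hi⟩
  rw [(Submodule.topologicalClosure_eq_top_iff).1 hd, Submodule.mem_bot, sub_eq_zero] at hu
  rw [hu]
  exact Submodule.starProjection_apply_mem K g

/-- The unbounded operator acting as the scalar `l i` on `V i`, with its maximal domain. -/
theorem exists_linearPMap_graph_iff [CompleteSpace H] (V : ι → Submodule ℂ H)
    (hd : (⨆ i, V i).topologicalClosure = ⊤) (l : ι → ℝ) :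
    ∃ T : H →ₗ.[ℂ] H, ∀ g h : H,
      (g, h) ∈ T.graph ↔ ∀ i, ∀ v ∈ V i, (l i : ℂ) * inner ℂ v g = inner ℂ v h := by
  let S : Submodule ℂ (H × H) :=
    { carrier := {q | ∀ i, ∀ v ∈ V i, (l i : ℂ) * inner ℂ v q.1 = inner ℂ v q.2}
      add_mem' := fun {a b} ha hb i v hv => by
        simp only [Prod.fst_add, Prod.snd_add, inner_add_right, mul_add, ha i v hv, hb i v hv]
      zero_mem' := fun i v hv => by simp
      smul_mem' := fun c a ha i v hv => by
        simp only [Prod.smul_fst, Prod.smul_snd, inner_smul_right, ← ha i v hv]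
        ring }
  refine ⟨S.toLinearPMap, fun g h => ?_⟩
  rw [Submodule.toLinearPMap_graph_eq]
  · rfl
  -- Single-valuedness: if the first component is `0`, the second is orthogonal to every `V i`,
  -- hence zero by density.
  · rintro ⟨a, b⟩ hab (rfl : a = 0)
    have : b ∈ (⨆ i, V i)ᗮ := by
      rw [← Submodule.iInf_orthogonal, Submodule.mem_iInf]
      refine fun i => (Submodule.mem_orthogonal _ _).2 fun v hv => ?_
      simpa using (hab i v hv).symm
    rwa [(Submodule.topologicalClosure_eq_top_iff).1 hd, Submodule.mem_bot] at this

/-- Tested against `v ∈ V i`, the eigenvalue equation reads `(l i - c) ⟨v, g⟩ = 0`, so it says that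
`g` is orthogonal to every `V i` with `l i ≠ c`. -/
theorem opEigenspace_eq_topologicalClosure [CompleteSpace H] (V : ι → Submodule ℂ H)
    (hV : ∀ i j, i ≠ j → V i ⟂ V j) (hd : (⨆ i, V i).topologicalClosure = ⊤) (l : ι → ℝ)
    {T : H →ₗ.[ℂ] H} (hT : ∀ g h : H,
      (g, h) ∈ T.graph ↔ ∀ i, ∀ v ∈ V i, (l i : ℂ) * inner ℂ v g = inner ℂ v h) (c : ℂ) :
    opEigenspace T c = (⨆ i : {i // (l i : ℂ) = c}, V i).topologicalClosure := by
  rw [← orthogonal_iSup_eq_topologicalClosure V hV hd fun i => (l i : ℂ) = c]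
  ext g
  rw [← Submodule.iInf_orthogonal, Submodule.mem_iInf, opEigenspace, Submodule.mem_comap]
  simp only [LinearMap.prod_apply, Function.prod, LinearMap.id_apply, LinearMap.smul_apply, hT,
    inner_smul_right, Submodule.mem_orthogonal, Subtype.forall]
  refine forall_congr' fun i => ⟨fun h hi v hv => ?_, fun h v hv => ?_⟩
  · have := h v hv
    rw [← sub_eq_zero, ← sub_mul, mul_eq_zero, sub_eq_zero] at this
    exact this.resolve_left hi
  · by_cases hi : (l i : ℂ) = c
    · rw [hi]
    · rw [h hi v hv]; simp

/-- A sesquilinear form that is diagonal along a dense orthogonal decomposition: description of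
the operator associated to its closure. -/
theorem closedForm_iff_diagonal {X : Type*} [AddCommGroup X] [Module ℂ X] [Countable ι]
    (J : X →ₗ[ℂ] H) (Q : X →ₗ⋆[ℂ] X →ₗ[ℂ] ℂ) (F : ι → Submodule ℂ X)
    [∀ i, FiniteDimensional ℂ (F i)] (hF : ⨆ i, F i = ⊤)
    (hV : ∀ i j, i ≠ j → (F i).map J ⟂ (F j).map J)
    (hd : (⨆ i, (F i).map J).topologicalClosure = ⊤) (l : ι → ℝ)
    (hQ : ∀ i, ∀ f ∈ F i, ∀ g, Q f g = -((l i : ℂ) * inner ℂ (J f) (J g))) (g h : H) :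
    (∃ φ : ℕ → X, Tendsto (fun n => J (φ n)) atTop (𝓝 g) ∧
      Tendsto (fun p : ℕ × ℕ => Q (φ p.1 - φ p.2) (φ p.1 - φ p.2)) atTop (𝓝 0) ∧
      ∀ f : X, Tendsto (fun n => Q f (φ n)) atTop (𝓝 (-inner ℂ (J f) h))) ↔
    ∀ i, ∀ v ∈ (F i).map J, (l i : ℂ) * inner ℂ v g = inner ℂ v h := by
  constructor
  · rintro ⟨φ, hφ, -, h3⟩ i _ ⟨f, hf, rfl⟩
    have h4 := h3 f
    simp only [hQ i f hf] at h4
    have h5 : Tendsto (fun n => -((l i : ℂ) * inner ℂ (J f) (J (φ n)))) atTop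
        (𝓝 (-((l i : ℂ) * inner ℂ (J f) g))) :=
      ((tendsto_const_nhds.inner hφ).const_mul _).neg
    exact neg_injective (tendsto_nhds_unique h5 h4)
  · intro hgh
    obtain ⟨e, he⟩ := exists_injective_nat ι
    -- Finite partial sums of the decomposition: finite-dimensional, so that projections exist, and
    -- inside the range of `J`, so that the projections of `g` lift to `X`.
    let U : ℕ → Submodule ℂ H := fun n => ⨆ i : {i // e i < n}, (F i).map J
    have hfin : ∀ n, FiniteDimensional ℂ (U n) := fun n => by
      have : Finite {i // e i < n} :=
        Finite.of_injective (fun i => (⟨e i.1, i.2⟩ : Fin n)) fun a b hab =>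
          Subtype.ext (he (congrArg Fin.val hab))
      exact Submodule.finite_iSup _
    have hmono : Monotone U := fun m n hmn =>
      iSup_le fun i => le_iSup_of_le (⟨i.1, i.2.trans_le hmn⟩ : {i // e i < n}) le_rfl
    have htop : ⊤ ≤ (⨆ n, U n).topologicalClosure := by
      rw [← hd]
      refine Submodule.topologicalClosure_mono (iSup_le fun i => ?_)
      exact le_iSup_of_le (e i + 1)
        (le_iSup_of_le (⟨i, Nat.lt_succ_self _⟩ : {j // e j < e i + 1}) le_rfl)
    have hlim : ∀ x : H, Tendsto (fun n => (U n).starProjection x) atTop (𝓝 x) := fun x =>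
      Submodule.starProjection_tendsto_self U hmono x htop
    have hrange : ∀ n, ∃ f : X, J f = (U n).starProjection g := fun n => by
      have h1 : U n ≤ LinearMap.range J := iSup_le fun i => LinearMap.map_le_range
      exact h1 (Submodule.starProjection_apply_mem _ _)
    choose φ hφ using hrange
    -- On summands inside `U n` this is the hypothesis on `(g, h)`; on the others both sides vanish
    -- by orthogonality.
    have key : ∀ n f, Q f (φ n) = -inner ℂ (J f) ((U n).starProjection h) := by
      intro n f
      have hf : f ∈ ⨆ i, F i := hF ▸ Submodule.mem_top
      induction hf using Submodule.iSup_induction' with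
      | mem i f hf =>
        rw [hQ i f hf, hφ]
        have hJf : J f ∈ (F i).map J := Submodule.mem_map_of_mem hf
        by_cases hi : e i < n
        · have hU : J f ∈ U n :=
            (le_iSup (fun i : {i // e i < n} => (F i).map J) ⟨i, hi⟩) hJf
          rw [← Submodule.inner_starProjection_left_eq_right,
            ← Submodule.inner_starProjection_left_eq_right,
            Submodule.starProjection_eq_self_iff.2 hU, hgh i _ hJf]
        · have hU : U n ≤ ((F i).map J)ᗮ := iSup_le fun j => hV j i fun h => hi (h ▸ j.2)
          have h0 : ∀ x, inner ℂ (J f) ((U n).starProjection x) = 0 := fun x =>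
            (Submodule.mem_orthogonal _ _).1 (hU (Submodule.starProjection_apply_mem _ _)) _ hJf
          rw [h0, h0]; simp
      | zero => simp
      | add f f' _ _ h1 h2 =>
        rw [map_add, LinearMap.add_apply, h1, h2, map_add, inner_add_left]; ring
    refine ⟨φ, ?_, ?_, fun f => ?_⟩
    · simpa only [hφ] using hlim g
    -- With `P_n` the projection onto `U n`, `key` turns the form value into `-⟨(P_m - P_n) g, (P_m
    -- - P_n) h⟩`, so convergence of the projections gives the Cauchy condition.
    · have h1 : ∀ x, Tendsto (fun p : ℕ × ℕ => (U p.1).starProjection x - (U p.2).starProjection x)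
          atTop (𝓝 0) := fun x => by
        rw [← prod_atTop_atTop_eq]
        simpa using ((hlim x).comp tendsto_fst).sub ((hlim x).comp tendsto_snd)
      have h2 := ((h1 g).inner (𝕜 := ℂ) (h1 h)).neg
      simp only [inner_zero_left, neg_zero] at h2
      refine h2.congr fun p => ?_
      rw [map_sub (Q _), key, key, map_sub, hφ, hφ, inner_sub_right]; ring
    · simp only [key]
      exact (tendsto_const_nhds.inner (hlim h)).neg

end Diagonal

variable {D : ℕ} {r : Fin D → ℝ}

/-! ### Cylinder sets and weights -/

/-- The initial segment with `n` vertices of an infinite path. -/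
def initSeg (x : InfPath D) (n : ℕ) : FinPath D := (List.range n).map x

lemma mem_cyl_iff {γ : FinPath D} {x : InfPath D} : x ∈ cyl γ ↔ initSeg x γ.length = γ := by
  constructor
  · intro h
    refine List.ext_getElem (by simp [initSeg]) fun i h1 h2 => ?_
    simpa [initSeg] using h ⟨i, h2⟩
  · intro h i
    have : γ.get i = (initSeg x γ.length)[i.1]'(by simp [initSeg]) := by
      simp only [h, List.get_eq_getElem]
    rw [this]; simp [initSeg]

lemma initSeg_prefix (x : InfPath D) {m n : ℕ} (h : m ≤ n) : initSeg x m <+: initSeg x n := by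
  obtain ⟨k, rfl⟩ := Nat.exists_eq_add_of_le h
  rw [initSeg, initSeg, List.range_add, List.map_append]
  exact List.prefix_append _ _

lemma initSeg_mem_cyl (x : InfPath D) (n : ℕ) : x ∈ cyl (initSeg x n) := by
  rw [mem_cyl_iff]; simp [initSeg]

@[simp] lemma cyl_nil : cyl ([] : FinPath D) = Set.univ := by
  ext x; simp [cyl]

lemma mem_cyl_concat {γ : FinPath D} {v : Fin D} {x : InfPath D} :
    x ∈ cyl (γ ++ [v]) ↔ x ∈ cyl γ ∧ x γ.length = v := by
  rw [mem_cyl_iff, mem_cyl_iff, List.length_append, List.length_singleton, initSeg, initSeg,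
    List.range_succ, List.map_append]
  constructor
  · intro h
    have := List.append_inj h (by simp)
    simpa using this
  · rintro ⟨h1, h2⟩
    rw [h1]; simp [h2]

lemma cyl_subset_of_prefix {γ γ' : FinPath D} (h : γ <+: γ') : cyl γ' ⊆ cyl γ := by
  intro x hx
  rw [mem_cyl_iff] at hx
  have h1 : initSeg x γ.length <+: γ' := by
    conv_rhs => rw [← hx]
    exact initSeg_prefix x h.length_le
  rw [mem_cyl_iff]
  exact ((List.prefix_of_prefix_length_le h1 h (by simp [initSeg])).eq_of_length
    (by simp [initSeg]))

lemma prefix_of_mem_cyl {γ γ' : FinPath D} {x : InfPath D} (h : x ∈ cyl γ) (h' : x ∈ cyl γ')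
    (hl : γ.length ≤ γ'.length) : γ <+: γ' := by
  rw [mem_cyl_iff] at h h'
  rw [← h, ← h']
  simpa [initSeg] using initSeg_prefix x hl

lemma disjoint_cyl {γ γ' : FinPath D} (hl : γ.length ≤ γ'.length) (h : ¬ γ <+: γ') :
    Disjoint (cyl γ) (cyl γ') :=
  Set.disjoint_left.2 fun _ hx hx' => h (prefix_of_mem_cyl hx hx' hl)

/-- The cylinder sets, together with the empty set, are closed under intersection. -/
lemma isPiSystem_cyl : IsPiSystem (Set.range (cyl (D := D))) := by
  rintro _ ⟨γ, rfl⟩ _ ⟨γ', rfl⟩ ⟨x, hx, hx'⟩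
  rcases le_total γ.length γ'.length with h | h
  · exact ⟨γ', (Set.inter_eq_right.2 (cyl_subset_of_prefix (prefix_of_mem_cyl hx hx' h))).symm⟩
  · exact ⟨γ, (Set.inter_eq_left.2 (cyl_subset_of_prefix (prefix_of_mem_cyl hx' hx h))).symm⟩

/-- Fixing the vertex at position `n` leaves countably many words of length `n` before it, so the
preimage is a countable union of cylinders. -/
lemma generateFrom_cyl :
    (MeasurableSpace.pi : MeasurableSpace (InfPath D)) =
      MeasurableSpace.generateFrom (Set.range (cyl (D := D))) := by
  refine le_antisymm ?_ (MeasurableSpace.generateFrom_le ?_)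
  · refine iSup_le fun n => ?_
    rw [← measurable_iff_comap_le]
    refine @measurable_to_countable' _ _ _ _ (_) _ fun v => ?_
    have : (fun x : InfPath D => x n) ⁻¹' {v} =
        ⋃ γ ∈ {γ : FinPath D | γ.length = n}, cyl (γ ++ [v]) := by
      ext x
      simp only [Set.mem_preimage, Set.mem_singleton_iff, Set.mem_iUnion, mem_cyl_concat,
        Set.mem_ofPred_eq, exists_prop]
      constructor
      · intro h
        exact ⟨initSeg x n, by simp [initSeg], initSeg_mem_cyl x n, by simpa [initSeg] using h⟩
      · rintro ⟨γ, rfl, -, h⟩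
        exact h
    rw [this]
    exact @MeasurableSet.biUnion _ _ (_) _ _ (Set.to_countable _) fun γ _ =>
      MeasurableSpace.measurableSet_generateFrom ⟨_, rfl⟩
  · rintro _ ⟨γ, rfl⟩
    exact measurableSet_cyl γ

lemma weight_nil : weight r [] = 1 := by simp [weight]

lemma weight_append (γ δ : FinPath D) : weight r (γ ++ δ) = weight r γ * weight r δ := by
  simp [weight]

lemma weight_concat (γ : FinPath D) (v : Fin D) : weight r (γ ++ [v]) = weight r γ * r v := by
  simp [weight]

lemma weight_ofFn {n : ℕ} (f : Fin n → Fin D) : weight r (List.ofFn f) = ∏ i, r (f i) := by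
  simp [weight, List.map_ofFn, List.prod_ofFn]

/-- Positive numbers with sum `1`, of which there are at least two. -/
structure IsProbVector (r : Fin D → ℝ) : Prop where
  two_le : 2 ≤ D
  pos : ∀ i, 0 < r i
  sum_eq_one : ∑ i, r i = 1

/-! ### The zeta function and the measure of cylinder sets -/

namespace IsProbVector

lemma exists_ne (hr : IsProbVector r) (i : Fin D) : ∃ j, j ≠ i := by
  have := Fin.nontrivial_iff_two_le.2 hr.two_le
  exact _root_.exists_ne i

lemma lt_one (hr : IsProbVector r) (i : Fin D) : r i < 1 := by
  obtain ⟨j, hj⟩ := hr.exists_ne i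
  rw [← hr.sum_eq_one]
  exact Finset.single_lt_sum hj (Finset.mem_univ _) (Finset.mem_univ _) (hr.pos j)
    fun k _ _ => (hr.pos k).le

lemma weight_pos (hr : IsProbVector r) (γ : FinPath D) : 0 < weight r γ :=
  List.prod_pos fun a ha => by
    obtain ⟨i, -, rfl⟩ := List.mem_map.1 ha
    exact hr.pos i

/-- `1 - ∑ r_i²`, the probability that two independent vertices differ. -/
lemma one_sub_sum_sq_pos (hr : IsProbVector r) : 0 < 1 - ∑ i, r i ^ 2 := by
  rw [sub_pos, ← hr.sum_eq_one]
  refine Finset.sum_lt_sum_of_nonempty ⟨⟨0, by have := hr.two_le; omega⟩, Finset.mem_univ _⟩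
    fun i _ => ?_
  nlinarith [hr.pos i, hr.lt_one i]

lemma one_lt_iff_sum_rpow_lt_one (hr : IsProbVector r) (t : ℝ) :
    ∑ i, r i ^ t < 1 ↔ 1 < t := by
  constructor
  · intro h
    by_contra! ht
    refine h.not_ge ?_
    rw [← hr.sum_eq_one]
    refine Finset.sum_le_sum fun i _ => ?_
    conv_lhs => rw [← Real.rpow_one (r i)]
    exact Real.rpow_le_rpow_of_exponent_ge (hr.pos i) (hr.lt_one i).le ht
  · intro ht
    rw [← hr.sum_eq_one]
    refine Finset.sum_lt_sum_of_nonempty ⟨⟨0, by have := hr.two_le; omega⟩, Finset.mem_univ _⟩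
      fun i _ => ?_
    conv_rhs => rw [← Real.rpow_one (r i)]
    exact Real.rpow_lt_rpow_of_exponent_gt (hr.pos i) (hr.lt_one i) ht

/-- Words of length `n` contribute `(∑ r_i^t)^n`, which leaves a geometric series. -/
lemma summable_weight_rpow_iff (hr : IsProbVector r) (t : ℝ) :
    Summable (fun γ : FinPath D => weight r γ ^ t) ↔ 1 < t := by
  rw [← hr.one_lt_iff_sum_rpow_lt_one t, ← List.equivSigmaTuple.symm.summable_iff,
    summable_sigma_of_nonneg fun x => by
      simpa using Real.rpow_nonneg (hr.weight_pos _).le t]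
  have hsum : ∀ n : ℕ, ∑' f : Fin n → Fin D,
      ((fun γ : FinPath D => weight r γ ^ t) ∘ List.equivSigmaTuple.symm) ⟨n, f⟩ =
        (∑ i, r i ^ t) ^ n := by
    intro n
    rw [tsum_fintype, Fintype.sum_pow]
    refine Finset.sum_congr rfl fun f _ => ?_
    simp only [Function.comp_apply, List.equivSigmaTuple_symm_apply]
    rw [weight_ofFn, Real.finsetProd_rpow _ _ fun i _ => (hr.pos _).le]
  simp only [hsum]
  rw [summable_geometric_iff_norm_lt_one, Real.norm_of_nonneg
    (Finset.sum_nonneg fun i _ => Real.rpow_nonneg (hr.pos i).le t)]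
  exact ⟨fun h => h.2, fun h => ⟨fun n => (hasSum_fintype _).summable, h⟩⟩

lemma abscissa_eq (hr : IsProbVector r) : abscissa r = 1 := by
  have : {t : ℝ | Summable fun γ : FinPath D => weight r γ ^ t} = Set.Ioi 1 := by
    ext t; exact hr.summable_weight_rpow_iff t
  rw [abscissa, this, csInf_Ioi]

/-- The limits defining the Dixmier measure. -/
lemma tendsto_zeta_ratio (hr : IsProbVector r) (γ : FinPath D) :
    Tendsto (fun t : ℝ => (∑' η : {η : FinPath D // γ <+: η}, weight r η.1 ^ t) / zeta r t)
      (𝓝[>] (abscissa r)) (𝓝 (weight r γ)) := by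
  rw [hr.abscissa_eq]
  have hlim : Tendsto (fun t : ℝ => weight r γ ^ t) (𝓝[>] 1) (𝓝 (weight r γ)) := by
    have := (Real.continuous_const_rpow (hr.weight_pos γ).ne').tendsto 1
    rw [Real.rpow_one] at this
    exact this.mono_left nhdsWithin_le_nhds
  refine hlim.congr' ?_
  filter_upwards [self_mem_nhdsWithin] with t ht
  -- Extensions of `γ` are the words `γ ++ δ`; multiplicativity of the weight factors out `w(γ)^t`.
  let e : FinPath D ≃ {η : FinPath D // γ <+: η} :=
    Equiv.ofBijective (fun δ => ⟨γ ++ δ, List.prefix_append _ _⟩)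
      ⟨fun a b h => List.append_cancel_left (congrArg Subtype.val h),
        fun ⟨_, δ, h⟩ => ⟨δ, Subtype.ext h⟩⟩
  have h1 : ∑' η : {η : FinPath D // γ <+: η}, weight r η.1 ^ t = weight r γ ^ t * zeta r t := by
    rw [← e.tsum_eq, zeta, ← tsum_mul_left]
    refine tsum_congr fun δ => ?_
    change weight r (γ ++ δ) ^ t = _
    rw [weight_append, Real.mul_rpow (hr.weight_pos _).le (hr.weight_pos _).le]
  have h2 : 0 < zeta r t :=
    ((hr.summable_weight_rpow_iff t).2 ht).tsum_pos
      (fun δ => (Real.rpow_pos_of_pos (hr.weight_pos δ) t).le) []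
      (Real.rpow_pos_of_pos (hr.weight_pos _) t)
  rw [h1, mul_div_assoc, div_self h2.ne', mul_one]

/-- The product measure with marginals `r` is a Dixmier measure. -/
lemma exists_isDixmierMeasure (hr : IsProbVector r) : ∃ μ, IsDixmierMeasure r μ := by
  let ν : Measure (Fin D) := ∑ i, ENNReal.ofReal (r i) • Measure.dirac i
  have hν : ∀ i, ν {i} = ENNReal.ofReal (r i) := fun i => by
    simp [ν, Measure.finsetSum_apply, Set.indicator_apply, Finset.sum_ite_eq']
  have : IsProbabilityMeasure ν := ⟨by
    simp only [ν, Measure.finsetSum_apply, Measure.smul_apply, measure_univ, smul_eq_mul, mul_one]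
    rw [← ENNReal.ofReal_sum_of_nonneg fun i _ => (hr.pos i).le, hr.sum_eq_one, ENNReal.ofReal_one]⟩
  refine ⟨Measure.infinitePi fun _ : ℕ => ν, inferInstance, fun γ => ?_⟩
  have hγ : (Measure.infinitePi fun _ : ℕ => ν).real (cyl γ) = weight r γ := by
    -- The lookup `γ[i]?` is total in `i : ℕ`, which presents the cylinder as a box over finitely
    -- many coordinates.
    have h : cyl γ = Set.pi (Finset.range γ.length : Set ℕ) fun i => {v | γ[i]? = some v} := by
      ext x
      simp only [cyl, Set.mem_ofPred_eq, Set.mem_pi, Finset.coe_range, Set.mem_Iio]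
      refine ⟨fun h i hi => ?_, fun h i => ?_⟩
      · rw [List.getElem?_eq_getElem hi, h ⟨i, hi⟩]; rfl
      · have := h i i.2
        rw [List.getElem?_eq_getElem i.2] at this
        exact (Option.some.inj this).symm
    rw [Measure.real, h, Measure.infinitePi_pi _ fun _ _ => MeasurableSet.of_discrete,
      Finset.prod_range]
    have h' : ∀ i : Fin γ.length, {v | γ[i.1]? = some v} = {γ.get i} := fun i => by
      ext v
      simp [eq_comm]
    simp only [h', hν]
    rw [ENNReal.toReal_prod]
    conv_rhs => rw [← List.ofFn_get γ, weight_ofFn]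
    exact Finset.prod_congr rfl fun i _ => ENNReal.toReal_ofReal (hr.pos _).le
  rw [hγ]
  exact hr.tendsto_zeta_ratio γ

lemma isDixmierMeasure_dixmierMeasure (hr : IsProbVector r) :
    IsDixmierMeasure r (dixmierMeasure r) := by
  rw [dixmierMeasure, dif_pos hr.exists_isDixmierMeasure]
  exact hr.exists_isDixmierMeasure.choose_spec

lemma isProbabilityMeasure_dixmierMeasure (hr : IsProbVector r) :
    IsProbabilityMeasure (dixmierMeasure r) :=
  hr.isDixmierMeasure_dixmierMeasure.1

/-- `dixmierMeasure` is a chosen witness, known through its limits on cylinders; uniqueness of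
limits identifies these values. -/
lemma measureReal_cyl (hr : IsProbVector r) (γ : FinPath D) :
    (dixmierMeasure r).real (cyl γ) = weight r γ :=
  tendsto_nhds_unique (hr.isDixmierMeasure_dixmierMeasure.2 γ) (hr.tendsto_zeta_ratio γ)

end IsProbVector

/-! ### The pairs of values of choice functions -/

/-- Weights of initial segments of `x` decrease strictly, as all `r_i < 1`, so equal weight forces
equal length: the first difference is at index `γ.length`. For `x = y` both sides fail. -/
lemma ultraDist_eq_weight_iff (hr : IsProbVector r) {γ : FinPath D} {x y : InfPath D}
    (hx : x ∈ cyl γ) (hy : y ∈ cyl γ) :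
    ultraDist r x y = weight r γ ↔ x γ.length ≠ y γ.length := by
  have hanti : StrictAnti fun n => weight r (initSeg x n) :=
    strictAnti_nat_of_succ_lt fun n => by
      have : initSeg x (n + 1) = initSeg x n ++ [x n] := by simp [initSeg, List.range_succ]
      rw [this, weight_concat]
      exact mul_lt_of_lt_one_right (hr.weight_pos _) (hr.lt_one _)
  have hmeet : meet x y = initSeg x (PiNat.firstDiff (E := fun _ => Fin D) x y) := by
    refine List.ext_getElem (by simp [meet, initSeg]) fun i h1 h2 => by simp [meet, initSeg]
  rw [mem_cyl_iff] at hx hy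
  have hxy : ∀ i < γ.length, x i = y i := fun i hi => by
    have h1 := hx.trans hy.symm
    have := congrArg (fun l => l[i]?) h1
    simpa [initSeg, hi] using this
  by_cases h : x = y
  · subst h
    simp [ultraDist, (hr.weight_pos γ).ne]
  · rw [ultraDist, if_neg h, hmeet]
    conv_lhs => rw [← hx]
    rw [hanti.injective.eq_iff]
    constructor
    · intro h1
      rw [← h1]
      exact PiNat.apply_firstDiff_ne h
    · intro h1
      rcases lt_trichotomy (PiNat.firstDiff (E := fun _ => Fin D) x y) γ.length with h2 | h2 | h2
      · exact absurd (hxy _ h2) (PiNat.apply_firstDiff_ne h)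
      · exact h2
      · exact absurd (PiNat.apply_eq_of_lt_firstDiff h2) h1

lemma choicePairs_eq (hr : IsProbVector r) (γ : FinPath D) :
    choicePairs r γ = (cyl γ ×ˢ cyl γ) \ ⋃ v : Fin D, cyl (γ ++ [v]) ×ˢ cyl (γ ++ [v]) := by
  ext ⟨x, y⟩
  simp only [choicePairs, Set.mem_ofPred_eq, Set.mem_sdiff, Set.mem_prod, Set.mem_iUnion,
    mem_cyl_concat]
  constructor
  · rintro ⟨hx, hy, h⟩
    rw [ultraDist_eq_weight_iff hr hx hy] at h
    exact ⟨⟨hx, hy⟩, fun ⟨v, h1, h2⟩ => h (h1.2.trans h2.2.symm)⟩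
  · rintro ⟨⟨hx, hy⟩, h⟩
    refine ⟨hx, hy, (ultraDist_eq_weight_iff hr hx hy).2 fun h1 => h ⟨_, ⟨hx, rfl⟩, hy, h1.symm⟩⟩

lemma measurableSet_choicePairs (hr : IsProbVector r) (γ : FinPath D) :
    MeasurableSet (choicePairs r γ) := by
  rw [choicePairs_eq hr]
  exact ((measurableSet_cyl γ).prod (measurableSet_cyl γ)).diff
    (MeasurableSet.iUnion fun v => (measurableSet_cyl _).prod (measurableSet_cyl _))

/-- The pairs splitting at `γ` form a square minus disjoint subsquares, and on squares the integrals
factor by Fubini. -/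
lemma setIntegral_choicePairs (hr : IsProbVector r) (γ : FinPath D)
    {E : Type*} [NormedAddCommGroup E] [NormedSpace ℝ E] {k : InfPath D × InfPath D → E}
    (hk : Integrable k ((dixmierMeasure r).prod (dixmierMeasure r))) :
    ∫ p in choicePairs r γ, k p ∂((dixmierMeasure r).prod (dixmierMeasure r)) =
      ∫ p in cyl γ ×ˢ cyl γ, k p ∂((dixmierMeasure r).prod (dixmierMeasure r)) -
        ∑ v : Fin D, ∫ p in cyl (γ ++ [v]) ×ˢ cyl (γ ++ [v]), k p
          ∂((dixmierMeasure r).prod (dixmierMeasure r)) := by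
  have hm : ∀ v : Fin D, MeasurableSet (cyl (γ ++ [v]) ×ˢ cyl (γ ++ [v])) :=
    fun v => (measurableSet_cyl _).prod (measurableSet_cyl _)
  rw [choicePairs_eq hr, setIntegral_sdiff (MeasurableSet.iUnion hm) hk.integrableOn,
    integral_iUnion_fintype hm _ fun v => hk.integrableOn]
  · intro v v' hvv'
    refine Set.disjoint_left.2 fun p hp hp' => hvv' ?_
    exact (mem_cyl_concat.1 hp.1).2.symm.trans (mem_cyl_concat.1 hp'.1).2
  · exact Set.iUnion_subset fun v => Set.prod_mono
      (cyl_subset_of_prefix (List.prefix_append _ _)) (cyl_subset_of_prefix (List.prefix_append _ _))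

lemma measureReal_choicePairs (hr : IsProbVector r) (γ : FinPath D) :
    ((dixmierMeasure r).prod (dixmierMeasure r)).real (choicePairs r γ) =
      weight r γ ^ 2 * (1 - ∑ i, r i ^ 2) := by
  have := setIntegral_choicePairs hr γ (k := fun _ => (1 : ℝ)) (integrable_const _)
  simp only [setIntegral_const, measureReal_prod_prod, hr.measureReal_cyl, smul_eq_mul, mul_one,
    weight_concat] at this
  rw [this, mul_sub, Finset.mul_sum]
  congr 1
  · ring
  · exact Finset.sum_congr rfl fun i _ => by ring

lemma isProbabilityMeasure_pairMeasure (hr : IsProbVector r) (γ : FinPath D) :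
    IsProbabilityMeasure (pairMeasure r γ) := by
  have hpos : 0 < ((dixmierMeasure r).prod (dixmierMeasure r)).real (choicePairs r γ) := by
    rw [measureReal_choicePairs hr]
    exact mul_pos (pow_pos (hr.weight_pos γ) 2) hr.one_sub_sum_sq_pos
  have h0 : ((dixmierMeasure r).prod (dixmierMeasure r)) (choicePairs r γ) ≠ 0 := fun h => by
    simp [Measure.real, h] at hpos
  have := ProbabilityTheory.cond_isProbabilityMeasure h0
  constructor
  rw [pairMeasure, (MeasurableEmbedding.subtype_coe (measurableSet_choicePairs hr γ)).comap_apply,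
    Set.image_univ, Subtype.range_coe,
    ProbabilityTheory.cond_apply (measurableSet_choicePairs hr γ), Set.inter_self,
    ENNReal.inv_mul_cancel h0 (measure_ne_top _ _)]

lemma integral_pairMeasure (hr : IsProbVector r) (γ : FinPath D)
    {E : Type*} [NormedAddCommGroup E] [NormedSpace ℝ E] (k : InfPath D × InfPath D → E) :
    ∫ p, k p.1 ∂(pairMeasure r γ) = (weight r γ ^ 2 * (1 - ∑ i, r i ^ 2))⁻¹ •
      ∫ p in choicePairs r γ, k p ∂((dixmierMeasure r).prod (dixmierMeasure r)) := by
  rw [pairMeasure, integral_subtype_comap (measurableSet_choicePairs hr γ),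
    ProbabilityTheory.cond, Measure.restrict_smul, integral_smul_measure,
    Measure.restrict_restrict (measurableSet_choicePairs hr γ), Set.inter_self,
    ← measureReal_choicePairs hr, ENNReal.toReal_inv]
  rfl

/-! ### The form `Q_s` as a sum over finite paths -/

/-- The integrand `conj (f x - f y) * (g x - g y)`. -/
def diffKernel {Ω : Type*} (f g : Ω → ℂ) (p : Ω × Ω) : ℂ :=
  starRingEnd ℂ (f p.1 - f p.2) * (g p.1 - g p.2)

/-- Expansion into products of a function of `p.1` and a function of `p.2`; the explicit factors `1`
put every term in the shape needed for Fubini. -/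
lemma diffKernel_eq {Ω : Type*} (f g : Ω → ℂ) : diffKernel f g = fun p : Ω × Ω =>
    ((starRingEnd ℂ (f p.1) * g p.1) * (1 : ℂ) - starRingEnd ℂ (f p.1) * g p.2) +
      ((1 : ℂ) * (starRingEnd ℂ (f p.2) * g p.2) - g p.1 * starRingEnd ℂ (f p.2)) := by
  ext p
  simp only [diffKernel, map_sub]
  ring

/-! ### Integrals of the difference kernel over squares -/

section DiffKernel

variable {Ω : Type*} [MeasurableSpace Ω] {ν : Measure Ω} {f g : Ω → ℂ}

lemma integrable_conj_mul (hf : MemLp f 2 ν) (hg : MemLp g 2 ν) :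
    Integrable (fun x => starRingEnd ℂ (f x) * g x) ν :=
  hf.star.integrable_mul hg

lemma integrable_conj [IsFiniteMeasure ν] (hf : MemLp f 2 ν) : Integrable (fun x => starRingEnd ℂ (f x)) ν :=
  hf.star.integrable one_le_two

lemma integrable_diffKernel [IsFiniteMeasure ν] (hf : MemLp f 2 ν) (hg : MemLp g 2 ν) :
    Integrable (diffKernel f g) (ν.prod ν) := by
  have hfg := integrable_conj_mul hf hg
  have hf' := integrable_conj hf
  have hg' := hg.integrable one_le_two
  have h1 : Integrable (fun _ : Ω => (1 : ℂ)) ν := integrable_const _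
  rw [diffKernel_eq]
  exact ((hfg.mul_prod h1).sub (hf'.mul_prod hg')).add ((h1.mul_prod hfg).sub (hg'.mul_prod hf'))

lemma integral_diffKernel [IsFiniteMeasure ν] (hf : MemLp f 2 ν) (hg : MemLp g 2 ν) :
    ∫ p, diffKernel f g p ∂(ν.prod ν) =
      2 * (ν.real Set.univ * ∫ x, starRingEnd ℂ (f x) * g x ∂ν -
        (∫ x, starRingEnd ℂ (f x) ∂ν) * ∫ x, g x ∂ν) := by
  have hfg := integrable_conj_mul hf hg
  have hf' := integrable_conj hf
  have hg' := hg.integrable one_le_two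
  have h1 : Integrable (fun _ : Ω => (1 : ℂ)) ν := integrable_const _
  rw [diffKernel_eq]
  refine ((integral_add ((hfg.mul_prod h1).sub (hf'.mul_prod hg'))
    ((h1.mul_prod hfg).sub (hg'.mul_prod hf'))).trans (congrArg₂ (· + ·)
      (integral_sub (hfg.mul_prod h1) (hf'.mul_prod hg'))
      (integral_sub (h1.mul_prod hfg) (hg'.mul_prod hf')))).trans ?_
  rw [integral_prod_mul (fun x => starRingEnd ℂ (f x) * g x) (fun _ => (1 : ℂ)),
    integral_prod_mul (fun _ => (1 : ℂ)) (fun x => starRingEnd ℂ (f x) * g x),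
    integral_prod_mul (fun x => starRingEnd ℂ (f x)) g,
    integral_prod_mul g (fun x => starRingEnd ℂ (f x))]
  simp only [integral_const, Complex.real_smul, mul_one]
  ring

lemma setIntegral_diffKernel [IsFiniteMeasure ν] (hf : MemLp f 2 ν) (hg : MemLp g 2 ν) (A : Set Ω) :
    ∫ p in A ×ˢ A, diffKernel f g p ∂(ν.prod ν) =
      2 * (ν.real A * ∫ x in A, starRingEnd ℂ (f x) * g x ∂ν -
        (∫ x in A, starRingEnd ℂ (f x) ∂ν) * ∫ x in A, g x ∂ν) := by
  rw [← Measure.prod_restrict, integral_diffKernel (hf.restrict A) (hg.restrict A),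
    measureReal_restrict_apply_univ]

end DiffKernel

/-- As `∑_{v ≠ v'} r_v r_{v'} = 1 - ∑ r_i²`, the last factor is the `μ × μ`-mass of `choicePairs r
γ`. This is why `G_s` is the constant that appears in the form. -/
lemma G_eq (hr : IsProbVector r) (s : ℝ) (γ : FinPath D) :
    G r s γ = 1 / 2 * weight r γ ^ (2 - s) * (weight r γ ^ 2 * (1 - ∑ i, r i ^ 2)) := by
  rw [G]
  congr 1
  have h : ∀ v : Fin D, ∑ v' ∈ Finset.univ.erase v,
      (dixmierMeasure r).real (cyl (γ ++ [v])) * (dixmierMeasure r).real (cyl (γ ++ [v'])) =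
        weight r γ ^ 2 * (r v - r v ^ 2) := by
    intro v
    have h1 := Finset.sum_erase_eq_sub (f := r) (Finset.mem_univ v)
    rw [hr.sum_eq_one] at h1
    simp only [hr.measureReal_cyl, weight_concat]
    rw [← Finset.mul_sum, ← Finset.mul_sum, h1]
    ring
  rw [Finset.sum_congr rfl fun v _ => h v, ← Finset.mul_sum, Finset.sum_sub_distrib, hr.sum_eq_one]

lemma G_pos (hr : IsProbVector r) (s : ℝ) (γ : FinPath D) : 0 < G r s γ := by
  rw [G_eq hr]
  have := hr.weight_pos γ
  have := hr.one_sub_sum_sq_pos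
  positivity

/-- The contribution of the path `γ` to the form `Q_s`. -/
def localForm (r : Fin D → ℝ) (s : ℝ) (γ : FinPath D) (f g : InfPath D → ℂ) : ℂ :=
  ((2 * G r s γ)⁻¹ : ℝ) *
    ∫ p in choicePairs r γ, diffKernel f g p ∂((dixmierMeasure r).prod (dixmierMeasure r))

lemma trace_block (s : ℝ) (τ : ChoiceFn r) (f g : InfPath D → ℂ) (γ : FinPath D)
    (hw : 0 < weight r γ) :
    (absDiracPow r (-s) γ * ((comm τ f γ)ᴴ * comm τ g γ)).trace =
      (2 * (weight r γ ^ s * (weight r γ ^ 2)⁻¹) : ℝ) * diffKernel f g (τ γ).1 := by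
  have h : ((weight r γ)⁻¹ ^ (-s) : ℝ) = weight r γ ^ s := by
    rw [Real.inv_rpow hw.le, Real.rpow_neg hw.le, inv_inv]
  simp only [absDiracPow, h, comm, dirac, rep, diffKernel, Matrix.trace_fin_two, Matrix.mul_apply,
    Fin.sum_univ_two, Matrix.conjTranspose_apply, Matrix.smul_apply, Matrix.sub_apply,
    Matrix.one_apply]
  simp
  ring

lemma integrable_pairMeasure (hr : IsProbVector r) (γ : FinPath D)
    {k : InfPath D × InfPath D → ℂ}
    (hk : Integrable k ((dixmierMeasure r).prod (dixmierMeasure r))) :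
    Integrable (fun p : choicePairs r γ => k p.1) (pairMeasure r γ) := by
  have hm := MeasurableEmbedding.subtype_coe (measurableSet_choicePairs hr γ)
  have := hr.isProbabilityMeasure_dixmierMeasure
  refine (hm.integrable_map_iff (g := k)).1 ?_
  rw [pairMeasure, hm.map_comap]
  refine Integrable.restrict ?_
  rw [ProbabilityTheory.cond]
  refine hk.restrict.smul_measure (ENNReal.inv_ne_top.2 fun h => ?_)
  have h2 := measureReal_choicePairs hr γ
  rw [Measure.real, h, ENNReal.toReal_zero] at h2
  exact (mul_pos (pow_pos (hr.weight_pos γ) 2) hr.one_sub_sum_sq_pos).ne h2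

/-- Evaluation at `γ` pushes the product measure to its factor `pairMeasure r γ`. -/
lemma integral_choiceMeasure (hr : IsProbVector r) (γ : FinPath D)
    {k : InfPath D × InfPath D → ℂ}
    (hk : Integrable k ((dixmierMeasure r).prod (dixmierMeasure r))) :
    Integrable (fun τ : ChoiceFn r => k (τ γ).1) (choiceMeasure r) ∧
    ∫ τ : ChoiceFn r, k (τ γ).1 ∂(choiceMeasure r) =
      ((weight r γ ^ 2 * (1 - ∑ i, r i ^ 2))⁻¹ : ℝ) *
        ∫ p in choicePairs r γ, k p ∂((dixmierMeasure r).prod (dixmierMeasure r)) := by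
  have h := isProbabilityMeasure_pairMeasure hr
  have hmp : MeasurePreserving (Function.eval γ) (choiceMeasure r) (pairMeasure r γ) := by
    rw [choiceMeasure, dif_pos h]
    exact measurePreserving_eval_infinitePi (fun γ => pairMeasure r γ) γ
  have hi := integrable_pairMeasure hr γ hk
  refine ⟨hmp.integrable_comp_of_integrable hi, ?_⟩
  rw [← Complex.real_smul, ← integral_pairMeasure hr, ← hmp.map_eq,
    integral_map hmp.aemeasurable (by rw [hmp.map_eq]; exact hi.aestronglyMeasurable)]

/-- Only finitely many blocks contribute, so trace and integral commute. The set `S` is left free: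
it can depend on `f` alone (for linearity in `g`), be the prefixes of a path, or be empty. -/
lemma formQ_eq_sum (hr : IsProbVector r) (s : ℝ) {f g : InfPath D → ℂ} (hf : f ∈ cylSpan D)
    (hg : g ∈ cylSpan D) (S : Finset (FinPath D))
    (hS : ∀ γ ∉ S, ∀ p ∈ choicePairs r γ, diffKernel f g p = 0) :
    formQ r s f g = ∑ γ ∈ S, localForm r s γ f g := by
  have hk : Integrable (diffKernel f g) ((dixmierMeasure r).prod (dixmierMeasure r)) :=
    integrable_diffKernel (memLp_of_mem_cylSpan r hf) (memLp_of_mem_cylSpan r hg)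
  have h1 : ∀ τ : ChoiceFn r,
      opTrace (fun γ => absDiracPow r (-s) γ * ((comm τ f γ)ᴴ * comm τ g γ)) =
        ∑ γ ∈ S, ((2 * (weight r γ ^ s * (weight r γ ^ 2)⁻¹) : ℝ) : ℂ) *
          diffKernel f g (τ γ).1 := by
    intro τ
    rw [opTrace, tsum_congr fun γ => trace_block s τ f g γ (hr.weight_pos γ)]
    exact tsum_eq_sum fun γ hγ => by rw [hS γ hγ _ (τ γ).2, mul_zero]
  rw [formQ, integral_congr_ae (ae_of_all _ h1), integral_finsetSum _ fun γ _ =>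
    (integral_choiceMeasure hr γ hk).1.const_mul _, Finset.mul_sum]
  refine Finset.sum_congr rfl fun γ _ => ?_
  rw [integral_const_mul, (integral_choiceMeasure hr γ hk).2, localForm, ← mul_assoc, ← mul_assoc]
  congr 1
  have hw := hr.weight_pos γ
  have hC := hr.one_sub_sum_sq_pos
  rw [G_eq hr, Real.rpow_sub hw, Real.rpow_two]
  have := Real.rpow_pos_of_pos hw s
  generalize weight r γ ^ s = a at *
  generalize 1 - ∑ i, r i ^ 2 = C at *
  generalize weight r γ = w at *
  have h2 : (1 / 2 : ℝ) * (2 * (a * (w ^ 2)⁻¹)) * (w ^ 2 * C)⁻¹ =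
      (2 * (1 / 2 * (w ^ 2 / a) * (w ^ 2 * C)))⁻¹ := by
    field_simp
  rw [← h2]
  push_cast
  rfl

/-- A function in the span of the characteristic functions of cylinder sets depends on finitely
many vertices only. -/
lemma exists_forall_eq_of_mem_cylSpan {f : InfPath D → ℂ} (hf : f ∈ cylSpan D) :
    ∃ N : ℕ, ∀ x y : InfPath D, (∀ i < N, x i = y i) → f x = f y := by
  induction hf using Submodule.span_induction with
  | mem f h =>
    obtain ⟨γ, rfl⟩ := h
    refine ⟨γ.length, fun x y hxy => ?_⟩
    have : x ∈ cyl γ ↔ y ∈ cyl γ := forall_congr' fun i => by rw [hxy i i.2]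
    by_cases hx : x ∈ cyl γ
    · simp only [Set.indicator_of_mem hx, Set.indicator_of_mem (this.1 hx)]
    · simp only [Set.indicator_of_notMem hx, Set.indicator_of_notMem (mt this.2 hx)]
  | zero => exact ⟨0, fun _ _ _ => rfl⟩
  | add f g _ _ hf hg =>
    obtain ⟨M, hM⟩ := hf
    obtain ⟨N, hN⟩ := hg
    refine ⟨max M N, fun x y hxy => ?_⟩
    simp only [Pi.add_apply]
    rw [hM x y fun i hi => hxy i (lt_max_of_lt_left hi),
      hN x y fun i hi => hxy i (lt_max_of_lt_right hi)]
  | smul c f _ hf =>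
    obtain ⟨N, hN⟩ := hf
    refine ⟨N, fun x y hxy => ?_⟩
    simp only [Pi.smul_apply]
    rw [hN x y hxy]

lemma eq_of_mem_cyl {γ : FinPath D} {x y : InfPath D} (hx : x ∈ cyl γ) (hy : y ∈ cyl γ) {i : ℕ}
    (hi : i < γ.length) : x i = y i :=
  (hx ⟨i, hi⟩).trans (hy ⟨i, hi⟩).symm

/-- Outside of a finite set of paths depending on `f`, the differences of `f` vanish. -/
lemma exists_finset_diff_eq_zero (r : Fin D → ℝ) {f : InfPath D → ℂ} (hf : f ∈ cylSpan D) :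
    ∃ S : Finset (FinPath D), ∀ γ ∉ S, ∀ p ∈ choicePairs r γ, f p.1 - f p.2 = 0 := by
  obtain ⟨N, hN⟩ := exists_forall_eq_of_mem_cylSpan hf
  refine ⟨(List.finite_length_lt (Fin D) N).toFinset, fun γ hγ p hp => sub_eq_zero.2 ?_⟩
  simp only [Set.Finite.mem_toFinset, Set.mem_ofPred_eq, not_lt] at hγ
  exact hN _ _ fun i hi => eq_of_mem_cyl hp.1 hp.2.1 (hi.trans_le hγ)

lemma localForm_conj (s : ℝ) (γ : FinPath D) (f g : InfPath D → ℂ) :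
    localForm r s γ g f = starRingEnd ℂ (localForm r s γ f g) := by
  rw [localForm, localForm, map_mul, Complex.conj_ofReal, ← integral_conj]
  congr 2
  ext p
  simp only [diffKernel, map_mul, Complex.conj_conj]
  ring

/-- Hermitian symmetry reduces linearity in the first argument to the second. -/
lemma formQ_conj (hr : IsProbVector r) (s : ℝ) {f g : InfPath D → ℂ} (hf : f ∈ cylSpan D)
    (hg : g ∈ cylSpan D) : formQ r s g f = starRingEnd ℂ (formQ r s f g) := by
  obtain ⟨S, hS⟩ := exists_finset_diff_eq_zero r hf
  rw [formQ_eq_sum hr s hf hg S fun γ hγ p hp => by rw [diffKernel, hS γ hγ p hp]; simp,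
    formQ_eq_sum hr s hg hf S fun γ hγ p hp => by rw [diffKernel, hS γ hγ p hp]; simp, map_sum]
  exact Finset.sum_congr rfl fun γ _ => localForm_conj s γ f g

lemma formQ_add_right (hr : IsProbVector r) (s : ℝ) {f g h : InfPath D → ℂ} (hf : f ∈ cylSpan D)
    (hg : g ∈ cylSpan D) (hh : h ∈ cylSpan D) :
    formQ r s f (g + h) = formQ r s f g + formQ r s f h := by
  obtain ⟨S, hS⟩ := exists_finset_diff_eq_zero r hf
  have hS' : ∀ k, ∀ γ ∉ S, ∀ p ∈ choicePairs r γ, diffKernel f k p = 0 :=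
    fun k γ hγ p hp => by rw [diffKernel, hS γ hγ p hp]; simp
  rw [formQ_eq_sum hr s hf (add_mem hg hh) S (hS' _), formQ_eq_sum hr s hf hg S (hS' _),
    formQ_eq_sum hr s hf hh S (hS' _), ← Finset.sum_add_distrib]
  refine Finset.sum_congr rfl fun γ _ => ?_
  have hf2 := memLp_of_mem_cylSpan r hf
  rw [localForm, localForm, localForm, ← mul_add, ← integral_add
    (integrable_diffKernel hf2 (memLp_of_mem_cylSpan r hg)).restrict
    (integrable_diffKernel hf2 (memLp_of_mem_cylSpan r hh)).restrict]
  congr 2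
  ext p
  simp only [diffKernel, Pi.add_apply]
  ring

lemma formQ_smul_right (hr : IsProbVector r) (s : ℝ) {f g : InfPath D → ℂ} (hf : f ∈ cylSpan D)
    (hg : g ∈ cylSpan D) (c : ℂ) : formQ r s f (c • g) = c * formQ r s f g := by
  obtain ⟨S, hS⟩ := exists_finset_diff_eq_zero r hf
  have hS' : ∀ k, ∀ γ ∉ S, ∀ p ∈ choicePairs r γ, diffKernel f k p = 0 :=
    fun k γ hγ p hp => by rw [diffKernel, hS γ hγ p hp]; simp
  rw [formQ_eq_sum hr s hf (Submodule.smul_mem _ c hg) S (hS' _),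
    formQ_eq_sum hr s hf hg S (hS' _), Finset.mul_sum]
  refine Finset.sum_congr rfl fun γ _ => ?_
  rw [localForm, localForm, mul_left_comm]
  congr 1
  rw [← integral_const_mul]
  refine integral_congr_ae (ae_of_all _ fun p => ?_)
  simp only [diffKernel, Pi.smul_apply, smul_eq_mul]
  ring

/-- The form `Q_s` as a sesquilinear form on the span of the characteristic functions. -/
def formQSesq (hr : IsProbVector r) (s : ℝ) : cylSpan D →ₗ⋆[ℂ] cylSpan D →ₗ[ℂ] ℂ :=
  LinearMap.mk₂'ₛₗ (starRingEnd ℂ) (RingHom.id ℂ) (fun f g => formQ r s f g)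
    (fun f f' g => by
      rw [formQ_conj hr s g.2 (f + f').2, Submodule.coe_add, formQ_add_right hr s g.2 f.2 f'.2,
        map_add, ← formQ_conj hr s g.2 f.2, ← formQ_conj hr s g.2 f'.2])
    (fun c f g => by
      rw [formQ_conj hr s g.2 (c • f).2, Submodule.coe_smul, formQ_smul_right hr s g.2 f.2,
        map_mul, ← formQ_conj hr s g.2 f.2, smul_eq_mul])
    (fun f g g' => formQ_add_right hr s f.2 g.2 g'.2)
    (fun c f g => formQ_smul_right hr s f.2 g.2 c)

/-! ### The form on functions of the next vertex -/

/-- The value of `Q_s` at a function `g` supported in `[η]`, depending there on the next vertex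
only, with integral `0`. -/
lemma formQ_eq_eigval (hr : IsProbVector r) (s : ℝ) (η : FinPath D) {f g : InfPath D → ℂ}
    (hf : f ∈ cylSpan D) (hg : g ∈ cylSpan D) (hsupp : ∀ x ∉ cyl η, g x = 0)
    (hconst : ∀ x ∈ cyl η, ∀ y ∈ cyl η, x η.length = y η.length → g x = g y)
    (hint : ∫ x, g x ∂(dixmierMeasure r) = 0) :
    formQ r s f g =
      -((eigval r s η : ℝ) * ∫ x, starRingEnd ℂ (f x) * g x ∂(dixmierMeasure r)) := by
  have hf2 := memLp_of_mem_cylSpan r hf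
  have hg2 := memLp_of_mem_cylSpan r hg
  set I := ∫ x, starRingEnd ℂ (f x) * g x ∂(dixmierMeasure r) with hI
  have hprefix : ∀ γ, γ <+: η → ∫ p in cyl γ ×ˢ cyl γ, diffKernel f g p
      ∂((dixmierMeasure r).prod (dixmierMeasure r)) = 2 * (weight r γ * I) := by
    -- As `[γ]` contains the support of `g`, its mean zero kills the product term.
    intro γ hγ
    have h0 : ∀ x ∉ cyl γ, g x = 0 := fun x hx => hsupp x fun h => hx (cyl_subset_of_prefix hγ h)
    rw [setIntegral_diffKernel hf2 hg2, hr.measureReal_cyl,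
      setIntegral_eq_integral_of_forall_compl_eq_zero fun x hx => by rw [h0 x hx, mul_zero],
      setIntegral_eq_integral_of_forall_compl_eq_zero (f := g) h0, hint, mul_zero, sub_zero]
  have hker : ∀ γ, ¬ γ <+: η → ∀ p ∈ cyl γ ×ˢ cyl γ, diffKernel f g p = 0 := by
    rintro γ hγ ⟨x, y⟩ ⟨hx, hy⟩
    -- Either `[γ]` misses `[η]`, or `γ` properly extends `η` and so fixes the next vertex.
    have : g x = g y := by
      rcases le_or_gt γ.length η.length with hl | hl
      · have hd := Set.disjoint_left.1 (disjoint_cyl hl hγ)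
        rw [hsupp x (hd hx), hsupp y (hd hy)]
      · by_cases hp : η <+: γ
        · exact hconst x (cyl_subset_of_prefix hp hx) y (cyl_subset_of_prefix hp hy)
            (eq_of_mem_cyl hx hy hl)
        · have hd := Set.disjoint_right.1 (disjoint_cyl hl.le hp)
          rw [hsupp x (hd hx), hsupp y (hd hy)]
    simp [diffKernel, this]
  have hnot : ∀ γ, ¬ γ <+: η → ∫ p in cyl γ ×ˢ cyl γ, diffKernel f g p
      ∂((dixmierMeasure r).prod (dixmierMeasure r)) = 0 := fun γ hγ =>
    setIntegral_eq_zero_of_forall_eq_zero (hker γ hγ)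
  have hinj : Set.InjOn η.take (Finset.range (η.length + 1) : Set ℕ) := by
    intro i hi j hj hij
    have := congrArg List.length hij
    simp only [Finset.coe_range, Set.mem_Iio, List.length_take] at *
    omega
  -- At `η` itself no subsquare `[ηv]²` contributes.
  have hlast : localForm r s η f g = ((weight r η / G r s η : ℝ) : ℂ) * I := by
    rw [localForm, setIntegral_choicePairs hr η (integrable_diffKernel hf2 hg2),
      hprefix η List.prefix_rfl, Finset.sum_eq_zero fun v _ => hnot _ fun h => by
        simpa using h.length_le]
    push_cast
    ring
  -- At a proper prefix only the subsquare in the direction of `η` survives, whence the difference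
  -- of two consecutive weights.
  have hstep : ∀ j ∈ Finset.range η.length, localForm r s (η.take j) f g =
      ((1 / G r s (η.take j) * (weight r (η.take j) - weight r (η.take (j + 1))) : ℝ) : ℂ) * I := by
    intro j hj
    rw [Finset.mem_range] at hj
    have htake : η.take j ++ [η[j]] = η.take (j + 1) := by simp
    rw [localForm, setIntegral_choicePairs hr _ (integrable_diffKernel hf2 hg2),
      hprefix _ (List.take_prefix _ _), Finset.sum_eq_single η[j], htake,
      hprefix _ (List.take_prefix _ _)]
    · push_cast
      ring
    · intro v _ hv
      refine hnot _ fun h => hv ?_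
      have h1 := (List.prefix_iff_eq_take.1 h)
      rw [List.length_append, List.length_take, List.length_singleton, min_eq_left hj.le,
        ← htake] at h1
      simpa using List.append_cancel_left h1
    · simp
  rw [formQ_eq_sum hr s hf hg ((Finset.range (η.length + 1)).image η.take) ?_,
    Finset.sum_image hinj, Finset.sum_range_succ, Finset.sum_congr rfl hstep, List.take_length,
    hlast, ← Finset.sum_mul, ← add_mul, ← neg_mul, eigval]
  · simp only [hr.measureReal_cyl]
    congr 1
    rw [← Complex.ofReal_sum, ← Complex.ofReal_add, ← Complex.ofReal_neg, neg_sub, sub_eq_add_neg,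
      add_comm, ← Finset.sum_neg_distrib]
    congr 2
    exact Finset.sum_congr rfl fun j _ => by ring
  · intro γ hγ p hp
    refine hker γ (fun h => hγ ?_) p ⟨hp.1, hp.2.1⟩
    exact Finset.mem_image.2 ⟨γ.length, Finset.mem_range.2 (Nat.lt_succ_of_le h.length_le),
      (List.prefix_iff_eq_take.1 h).symm⟩

/-- Measures decrease along prefixes, so the sum is nonpositive, and the last term is strictly
negative. -/
lemma eigval_neg (hr : IsProbVector r) (s : ℝ) (η : FinPath D) : eigval r s η < 0 := by
  simp only [eigval, hr.measureReal_cyl]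
  have h1 : ∑ j ∈ Finset.range η.length, 1 / G r s (η.take j) *
      (weight r (η.take (j + 1)) - weight r (η.take j)) ≤ 0 := by
    refine Finset.sum_nonpos fun j hj => ?_
    rw [Finset.mem_range] at hj
    have htake : η.take (j + 1) = η.take j ++ [η[j]] := by simp
    have h2 : weight r (η.take (j + 1)) - weight r (η.take j) ≤ 0 := by
      rw [htake, weight_concat, sub_nonpos]
      exact mul_le_of_le_one_right (hr.weight_pos _).le (hr.lt_one _).le
    exact mul_nonpos_of_nonneg_of_nonpos (one_div_pos.2 (G_pos hr s _)).le h2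
  have h3 := div_pos (hr.weight_pos η) (G_pos hr s η)
  linarith

/-! ### The orthogonal decomposition -/

/-- The map from the span of the characteristic functions to `L²`. -/
def toL2Lin (r : Fin D → ℝ) : cylSpan D →ₗ[ℂ] L2 r where
  toFun := toL2 r
  map_add' _ _ := rfl
  map_smul' _ _ := rfl

lemma inner_toL2 (f g : cylSpan D) : inner ℂ (toL2 r f) (toL2 r g) =
    ∫ x, starRingEnd ℂ (f.1 x) * g.1 x ∂(dixmierMeasure r) := by
  rw [L2.inner_def]
  refine integral_congr_ae ?_
  filter_upwards [(memLp_of_mem_cylSpan r f.2).coeFn_toLp,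
    (memLp_of_mem_cylSpan r g.2).coeFn_toLp] with x hx hy
  rw [toL2, toL2, hx, hy, RCLike.inner_apply, mul_comm]

lemma chi_eq_indicatorConstLp (γ : FinPath D) :
    chi r γ = indicatorConstLp 2 (measurableSet_cyl γ) (measure_ne_top _ _) (1 : ℂ) := rfl

lemma inner_chi_chi_of_prefix (hr : IsProbVector r) {γ γ' : FinPath D} (h : γ <+: γ') :
    inner ℂ (chi r γ) (chi r γ') = (weight r γ' : ℂ) := by
  rw [chi_eq_indicatorConstLp, chi_eq_indicatorConstLp,
    L2.inner_indicatorConstLp_one_indicatorConstLp_one,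
    Set.inter_eq_right.2 (cyl_subset_of_prefix h), hr.measureReal_cyl]
  rfl

lemma inner_chi_chi_of_not_prefix {γ γ' : FinPath D} (hl : γ.length ≤ γ'.length)
    (h : ¬ γ <+: γ') : inner ℂ (chi r γ) (chi r γ') = 0 := by
  rw [chi_eq_indicatorConstLp, chi_eq_indicatorConstLp,
    L2.inner_indicatorConstLp_one_indicatorConstLp_one, (disjoint_cyl hl h).inter_eq]
  simp

/-- The characteristic function of a cylinder set. -/
def chiFun (γ : FinPath D) : cylSpan D :=
  ⟨(cyl γ).indicator fun _ => (1 : ℂ), Submodule.subset_span ⟨γ, rfl⟩⟩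

/-- The function `χ_[ηv] / μ[ηv] - χ_[ηv'] / μ[ηv']`. -/
def haarFun (r : Fin D → ℝ) (η : FinPath D) (v v' : Fin D) : cylSpan D :=
  (((dixmierMeasure r).real (cyl (η ++ [v])))⁻¹ : ℂ) • chiFun (η ++ [v])
    - (((dixmierMeasure r).real (cyl (η ++ [v'])))⁻¹ : ℂ) • chiFun (η ++ [v'])

lemma toL2Lin_haarFun (η : FinPath D) (v v' : Fin D) : toL2Lin r (haarFun r η v v') =
    (((dixmierMeasure r).real (cyl (η ++ [v])))⁻¹ : ℂ) • chi r (η ++ [v])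
      - (((dixmierMeasure r).real (cyl (η ++ [v'])))⁻¹ : ℂ) • chi r (η ++ [v']) := rfl

/-- The constants, for `none`, and the span of the functions `haarFun r η v v'`, for `η`. -/
def haarSpace (r : Fin D → ℝ) : Option (FinPath D) → Submodule ℂ (cylSpan D)
  | none => Submodule.span ℂ {chiFun []}
  | some η => Submodule.span ℂ (Set.range fun p : Fin D × Fin D => haarFun r η p.1 p.2)

instance (i : Option (FinPath D)) : FiniteDimensional ℂ (haarSpace r i) := by
  cases i with
  | none => exact FiniteDimensional.span_of_finite ℂ (Set.finite_singleton _)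
  | some η => exact FiniteDimensional.span_of_finite ℂ (Set.finite_range _)

lemma map_haarSpace_none : (haarSpace r none).map (toL2Lin r) = Submodule.span ℂ {chi r []} := by
  rw [haarSpace, Submodule.map_span, Set.image_singleton]
  rfl

lemma map_haarSpace_some (η : FinPath D) : (haarSpace r (some η)).map (toL2Lin r) = E r η := by
  rw [haarSpace, Submodule.map_span, E]
  refine le_antisymm (Submodule.span_le.2 ?_) (Submodule.span_mono ?_)
  · rintro _ ⟨_, ⟨⟨v, v'⟩, rfl⟩, rfl⟩
    by_cases h : v = v'
    · subst h
      simp [haarFun]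
    · exact Submodule.subset_span ⟨v, v', h, toL2Lin_haarFun η v v'⟩
  · rintro _ ⟨v, v', -, rfl⟩
    exact ⟨_, ⟨(v, v'), rfl⟩, toL2Lin_haarFun η v v'⟩

/-- If `γ` is a prefix of `η`, the inner product is the full integral `1 - 1`; otherwise `[γ]` is
disjoint from both cylinders in the support. -/
lemma inner_chi_haarFun_eq_zero (hr : IsProbVector r) {γ η : FinPath D} (v v' : Fin D)
    (hl : γ.length ≤ η.length + 1) (hne : ∀ u, γ ≠ η ++ [u]) :
    inner ℂ (chi r γ) (toL2Lin r (haarFun r η v v')) = 0 := by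
  rw [toL2Lin_haarFun, inner_sub_right, inner_smul_right, inner_smul_right]
  by_cases h : γ <+: η
  · rw [inner_chi_chi_of_prefix hr (h.trans (List.prefix_append _ _)),
      inner_chi_chi_of_prefix hr (h.trans (List.prefix_append _ _)), hr.measureReal_cyl,
      hr.measureReal_cyl, inv_mul_cancel₀ (Complex.ofReal_ne_zero.2 (hr.weight_pos _).ne'),
      inv_mul_cancel₀ (Complex.ofReal_ne_zero.2 (hr.weight_pos _).ne'), sub_self]
  · have h1 : ∀ u, ¬ γ <+: η ++ [u] := fun u hu =>
      (List.prefix_concat_iff.1 hu).elim (hne u) h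
    rw [inner_chi_chi_of_not_prefix (by simpa using hl) (h1 v),
      inner_chi_chi_of_not_prefix (by simpa using hl) (h1 v')]
    simp

lemma inner_chi_haarFun_self (hr : IsProbVector r) (η : FinPath D) {v v' : Fin D} (h : v ≠ v') :
    inner ℂ (chi r (η ++ [v])) (toL2Lin r (haarFun r η v v')) = 1 := by
  rw [toL2Lin_haarFun, inner_sub_right, inner_smul_right, inner_smul_right,
    inner_chi_chi_of_prefix hr List.prefix_rfl, inner_chi_chi_of_not_prefix (by simp) fun h' =>
      h (by simpa using h'.eq_of_length (by simp)), hr.measureReal_cyl,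
    inv_mul_cancel₀ (Complex.ofReal_ne_zero.2 (hr.weight_pos _).ne')]
  simp

lemma inner_haarFun_haarFun (hr : IsProbVector r) {η η' : FinPath D} (h : η ≠ η')
    (hl : η.length ≤ η'.length) (u u' v v' : Fin D) :
    inner ℂ (toL2Lin r (haarFun r η u u')) (toL2Lin r (haarFun r η' v v')) = 0 := by
  have h0 : ∀ u, inner ℂ (chi r (η ++ [u])) (toL2Lin r (haarFun r η' v v')) = 0 := fun u =>
    inner_chi_haarFun_eq_zero hr v v' (by simpa using hl) fun w hw =>
      h (List.append_inj_left' hw rfl)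
  rw [toL2Lin_haarFun, inner_sub_left, inner_smul_left, inner_smul_left, h0, h0]
  simp

lemma isOrtho_map_haarSpace (hr : IsProbVector r) (i j : Option (FinPath D)) (hij : i ≠ j) :
    (haarSpace r i).map (toL2Lin r) ⟂ (haarSpace r j).map (toL2Lin r) := by
  have h1 : ∀ η, (haarSpace r none).map (toL2Lin r) ⟂ (haarSpace r (some η)).map (toL2Lin r) := by
    intro η
    rw [haarSpace, haarSpace, Submodule.map_span, Submodule.map_span, Submodule.isOrtho_span]
    rintro _ ⟨_, rfl, rfl⟩ _ ⟨_, ⟨p, rfl⟩, rfl⟩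
    exact inner_chi_haarFun_eq_zero hr _ _ (by simp) fun u => by simp
  have h2 : ∀ η η', η ≠ η' → η.length ≤ η'.length →
      (haarSpace r (some η)).map (toL2Lin r) ⟂ (haarSpace r (some η')).map (toL2Lin r) := by
    intro η η' hne hl
    rw [haarSpace, haarSpace, Submodule.map_span, Submodule.map_span, Submodule.isOrtho_span]
    rintro _ ⟨_, ⟨p, rfl⟩, rfl⟩ _ ⟨_, ⟨q, rfl⟩, rfl⟩
    exact inner_haarFun_haarFun hr hne hl _ _ _ _
  cases i with
  | none =>
    cases j with
    | none => exact absurd rfl hij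
    | some η => exact h1 η
  | some η =>
    cases j with
    | none => exact (h1 η).symm
    | some η' =>
      have hne : η ≠ η' := fun h => hij (congrArg some h)
      rcases le_total η.length η'.length with h | h
      · exact h2 _ _ hne h
      · exact (h2 _ _ hne.symm h).symm

lemma chiFun_eq_sum (γ : FinPath D) : chiFun γ = ∑ v, chiFun (γ ++ [v]) := by
  ext x
  rw [Submodule.coe_sum, Finset.sum_apply]
  simp only [chiFun]
  by_cases hx : x ∈ cyl γ
  · rw [Finset.sum_eq_single (x γ.length)]
    · rw [Set.indicator_of_mem hx, Set.indicator_of_mem (mem_cyl_concat.2 ⟨hx, rfl⟩)]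
    · intro v _ hv
      exact Set.indicator_of_notMem (fun h => hv (mem_cyl_concat.1 h).2.symm) _
    · simp
  · rw [Set.indicator_of_notMem hx, Finset.sum_eq_zero fun v _ =>
      Set.indicator_of_notMem (fun h => hx (mem_cyl_concat.1 h).1) _]

/-- The weighted sum of Haar functions equals `χ_[γv] / r_v - χ_[γ]`, because the weights `w(γv')`
add up to `w(γ)`. It drives the induction on words in `iSup_haarSpace`. -/
lemma chiFun_concat (hr : IsProbVector r) (γ : FinPath D) (v : Fin D) :
    chiFun (γ ++ [v]) = (r v : ℂ) • (chiFun γ +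
      ∑ v', (weight r (γ ++ [v']) : ℂ) • haarFun r γ v v') := by
  have hw : ∀ γ, (weight r γ : ℂ) ≠ 0 := fun γ => Complex.ofReal_ne_zero.2 (hr.weight_pos γ).ne'
  have h1 : ∑ v', (weight r (γ ++ [v']) : ℂ) = weight r γ := by
    rw [← Complex.ofReal_sum]
    simp only [weight_concat]
    rw [← Finset.mul_sum, hr.sum_eq_one, mul_one]
  simp only [haarFun, hr.measureReal_cyl, smul_sub, Finset.sum_sub_distrib, smul_smul,
    mul_inv_cancel₀ (hw _), one_smul]
  rw [← chiFun_eq_sum, add_sub_cancel, ← Finset.sum_smul, ← Finset.sum_mul, h1, smul_smul,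
    weight_concat]
  have hv : (r v : ℂ) ≠ 0 := Complex.ofReal_ne_zero.2 (hr.pos v).ne'
  have h2 : (r v : ℂ) * (weight r γ * ((weight r γ * r v : ℝ) : ℂ)⁻¹) = 1 := by
    push_cast
    field_simp [hw γ]
  rw [h2, one_smul]

lemma iSup_haarSpace (hr : IsProbVector r) : ⨆ i, haarSpace r i = ⊤ := by
  have hchi : ∀ γ, chiFun γ ∈ ⨆ i, haarSpace r i := by
    intro γ
    induction γ using List.reverseRecOn with
    | nil => exact le_iSup (haarSpace r) none (Submodule.mem_span_singleton_self _)
    | append_singleton γ v ih =>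
      rw [chiFun_concat hr]
      refine Submodule.smul_mem _ _ (add_mem ih (sum_mem fun v' _ => Submodule.smul_mem _ _ ?_))
      exact le_iSup (haarSpace r) (some γ) (Submodule.subset_span ⟨(v, v'), rfl⟩)
  have h : Submodule.span ℂ (Set.range (chiFun (D := D))) = ⊤ := by
    have h := Submodule.span_span_coe_preimage (R := ℂ)
      (s := Set.range fun γ : FinPath D => (cyl γ).indicator fun _ => (1 : ℂ))
    have h' : Set.range (chiFun (D := D)) = ((↑) : cylSpan D → InfPath D → ℂ) ⁻¹'
        Set.range fun γ : FinPath D => (cyl γ).indicator fun _ => (1 : ℂ) := by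
      ext x
      exact ⟨fun ⟨γ, hγ⟩ => ⟨γ, congrArg Subtype.val hγ⟩, fun ⟨γ, hγ⟩ => ⟨γ, Subtype.ext hγ⟩⟩
    rw [h']
    exact h
  rw [eq_top_iff, ← h, Submodule.span_le]
  rintro _ ⟨γ, rfl⟩
  exact hchi γ

/-- The characteristic functions of the cylinder sets span a dense subspace. -/
lemma dense_range_toL2Lin (r : Fin D → ℝ) :
    (LinearMap.range (toL2Lin r)).topologicalClosure = ⊤ := by
  rw [Submodule.topologicalClosure_eq_top_iff, Submodule.eq_bot_iff]
  intro g hg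
  have hcyl : ∀ γ, ∫ x in cyl γ, g x ∂(dixmierMeasure r) = 0 := fun γ => by
    rw [← L2.inner_indicatorConstLp_one (measurableSet_cyl γ) (measure_ne_top _ _)]
    exact (Submodule.mem_orthogonal _ _).1 hg (chi r γ) ⟨chiFun γ, rfl⟩
  have hint : Integrable g (dixmierMeasure r) := (Lp.memLp g).integrable one_le_two
  have hall : ∀ A, MeasurableSet A → ∫ x in A, g x ∂(dixmierMeasure r) = 0 := by
    intro A hA
    induction A, hA using MeasurableSpace.induction_on_inter generateFrom_cyl isPiSystem_cyl with
    | empty => simp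
    | basic t ht =>
      obtain ⟨γ, rfl⟩ := ht
      exact hcyl γ
    | compl t htm ih =>
      -- The whole space is the cylinder of the empty path, so `g` has total integral zero.
      have h0 := hcyl []
      rw [cyl_nil, setIntegral_univ] at h0
      have := integral_add_compl htm hint
      rwa [ih, h0, zero_add] at this
    | iUnion f hd hm ih =>
      rw [integral_iUnion hm hd hint.integrableOn]
      simp [ih]
  rw [Lp.eq_zero_iff_ae_eq_zero]
  exact hint.ae_eq_zero_of_forall_setIntegral_eq_zero fun A hA _ => hall A hA

lemma dense_iSup_map_haarSpace (hr : IsProbVector r) :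
    (⨆ i, (haarSpace r i).map (toL2Lin r)).topologicalClosure = ⊤ := by
  rw [← Submodule.map_iSup, iSup_haarSpace hr, Submodule.map_top, dense_range_toL2Lin]

/-! ### The eigenvalues of the Laplace–Beltrami operator -/

/-- The eigenvalue on `haarSpace r i`. -/
def haarEigval (r : Fin D → ℝ) (s : ℝ) : Option (FinPath D) → ℝ
  | none => 0
  | some η => eigval r s η

lemma formQSesq_haarFun (hr : IsProbVector r) (s : ℝ) (η : FinPath D) (v v' : Fin D)
    (f : cylSpan D) : formQSesq hr s f (haarFun r η v v') =
      -((eigval r s η : ℂ) * inner ℂ (toL2 r f) (toL2 r (haarFun r η v v'))) := by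
  rw [inner_toL2]
  have happ : ∀ x, (haarFun r η v v').1 x =
      ((weight r (η ++ [v]) : ℂ)⁻¹) * (cyl (η ++ [v])).indicator (fun _ => (1 : ℂ)) x -
        ((weight r (η ++ [v']) : ℂ)⁻¹) * (cyl (η ++ [v'])).indicator (fun _ => (1 : ℂ)) x := by
    intro x
    simp only [haarFun, hr.measureReal_cyl]
    rfl
  refine formQ_eq_eigval hr s η f.2 (haarFun r η v v').2 (fun x hx => ?_)
    (fun x hx y hy hxy => ?_) ?_
  · rw [happ, Set.indicator_of_notMem fun h => hx (mem_cyl_concat.1 h).1,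
      Set.indicator_of_notMem fun h => hx (mem_cyl_concat.1 h).1]
    simp
  · have hi : ∀ u, (cyl (η ++ [u])).indicator (fun _ => (1 : ℂ)) x =
        (cyl (η ++ [u])).indicator (fun _ => (1 : ℂ)) y := fun u => by
      classical
      simp only [Set.indicator_apply, mem_cyl_concat, hx, hy, hxy]
    rw [happ, happ, hi, hi]
  · have h := inner_chi_haarFun_eq_zero hr (γ := []) (η := η) v v' (by simp) fun u => by simp
    have h' := inner_toL2 (r := r) (chiFun []) (haarFun r η v v')
    rw [show inner ℂ (toL2 r (chiFun [])) (toL2 r (haarFun r η v v')) = 0 from h] at h'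
    simpa [chiFun] using h'.symm

lemma formQSesq_chiFun_nil (hr : IsProbVector r) (s : ℝ) (f : cylSpan D) :
    formQSesq hr s f (chiFun []) = 0 := by
  refine (formQ_eq_sum hr s f.2 (chiFun []).2 ∅ fun γ _ p _ => ?_).trans Finset.sum_empty
  simp [diffKernel, chiFun]

/-- The computation has the eigenfunction in the second slot; Hermitian symmetry and the reality of
the scalar move it to the first, as `closedForm_iff_diagonal` requires. -/
lemma formQSesq_haarSpace (hr : IsProbVector r) (s : ℝ) (i : Option (FinPath D)) (f : cylSpan D)
    (hf : f ∈ haarSpace r i) (g : cylSpan D) : formQSesq hr s f g =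
      -((haarEigval r s i : ℂ) * inner ℂ (toL2Lin r f) (toL2Lin r g)) := by
  have h : formQSesq hr s g f =
      -((haarEigval r s i : ℂ) * inner ℂ (toL2Lin r g) (toL2Lin r f)) := by
    cases i with
    | none =>
      obtain ⟨c, rfl⟩ := Submodule.mem_span_singleton.1 hf
      rw [map_smul, formQSesq_chiFun_nil, haarEigval]
      simp
    | some η =>
      induction hf using Submodule.span_induction with
      | mem f h =>
        obtain ⟨p, rfl⟩ := h
        exact formQSesq_haarFun hr s η _ _ g
      | zero => simp
      | add f f' _ _ h h' => rw [map_add, map_add, inner_add_right, h, h']; ring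
      | smul c f _ h => rw [map_smul, map_smul, inner_smul_right, h, smul_eq_mul]; ring
  have hc : formQSesq hr s f g = starRingEnd ℂ (formQSesq hr s g f) := formQ_conj hr s g.2 f.2
  rw [hc, h, map_neg, map_mul, Complex.conj_ofReal, inner_conj_symm]

/-- The diagonal operator also witnesses that an operator with graph `LaplaceRel` exists, so the
definition does not fall back to its default `0`. -/
lemma laplaceBeltrami_graph_iff (hr : IsProbVector r) (s : ℝ) (g h : L2 r) :
    (g, h) ∈ (laplaceBeltrami r s).graph ↔ ∀ i, ∀ v ∈ (haarSpace r i).map (toL2Lin r),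
      (haarEigval r s i : ℂ) * inner ℂ v g = inner ℂ v h := by
  have hrel : ∀ g h, LaplaceRel r s g h ↔ ∀ i, ∀ v ∈ (haarSpace r i).map (toL2Lin r),
      (haarEigval r s i : ℂ) * inner ℂ v g = inner ℂ v h :=
    closedForm_iff_diagonal (toL2Lin r) (formQSesq hr s) (haarSpace r) (iSup_haarSpace hr)
      (isOrtho_map_haarSpace hr) (dense_iSup_map_haarSpace hr) (haarEigval r s)
      (formQSesq_haarSpace hr s)
  have hex : ∃ T : L2 r →ₗ.[ℂ] L2 r, ∀ g h : L2 r, (g, h) ∈ T.graph ↔ LaplaceRel r s g h := by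
    obtain ⟨T, hT⟩ := exists_linearPMap_graph_iff _ (dense_iSup_map_haarSpace hr) (haarEigval r s)
    exact ⟨T, fun g h => (hT g h).trans (hrel g h).symm⟩
  rw [laplaceBeltrami, dif_pos hex, hex.choose_spec, hrel]

lemma opEigenspace_laplaceBeltrami (hr : IsProbVector r) (s : ℝ) (c : ℂ) :
    opEigenspace (laplaceBeltrami r s) c =
      (⨆ i : {i // (haarEigval r s i : ℂ) = c},
        (haarSpace r i).map (toL2Lin r)).topologicalClosure :=
  opEigenspace_eq_topologicalClosure _ (isOrtho_map_haarSpace hr) (dense_iSup_map_haarSpace hr) _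
    (laplaceBeltrami_graph_iff hr s) c

lemma opEigenspace_laplaceBeltrami_zero (hr : IsProbVector r) (s : ℝ) :
    opEigenspace (laplaceBeltrami r s) 0 = Submodule.span ℂ {chi r []} := by
  have h : (⨆ i : {i // (haarEigval r s i : ℂ) = 0}, (haarSpace r i).map (toL2Lin r)) =
      Submodule.span ℂ {chi r []} := by
    rw [← map_haarSpace_none]
    refine le_antisymm (iSup_le ?_)
      (le_iSup (fun i : {i // (haarEigval r s i : ℂ) = 0} => (haarSpace r i).map (toL2Lin r))
        ⟨none, by simp [haarEigval]⟩)
    rintro ⟨_ | η, hi⟩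
    · exact le_rfl
    · exact absurd (Complex.ofReal_eq_zero.1 hi) (eigval_neg hr s η).ne
  rw [opEigenspace_laplaceBeltrami hr, h]
  exact (Submodule.closed_of_finiteDimensional _).submodule_topologicalClosure_eq

lemma opEigenspace_laplaceBeltrami_ne_zero (hr : IsProbVector r) (s : ℝ) {c : ℂ} (hc : c ≠ 0) :
    opEigenspace (laplaceBeltrami r s) c =
      (⨆ η : {η : FinPath D // ((eigval r s η : ℝ) : ℂ) = c}, E r η.1).topologicalClosure := by
  rw [opEigenspace_laplaceBeltrami hr]
  congr 1
  refine le_antisymm (iSup_le ?_) (iSup_le fun η => ?_)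
  · rintro ⟨_ | η, hi⟩
    · exact absurd hi.symm (by simpa [haarEigval] using hc)
    · rw [map_haarSpace_some]
      exact le_iSup (fun η : {η : FinPath D // ((eigval r s η : ℝ) : ℂ) = c} => E r η.1) ⟨η, hi⟩
  · rw [← map_haarSpace_some]
    exact le_iSup (fun i : {i // (haarEigval r s i : ℂ) = c} => (haarSpace r i).map (toL2Lin r))
      ⟨some η.1, η.2⟩

lemma chi_nil_ne_zero (hr : IsProbVector r) : chi r [] ≠ 0 := fun h => by
  have := inner_chi_chi_of_prefix hr (List.prefix_refl ([] : FinPath D))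
  rw [h, inner_zero_left, weight_nil] at this
  simp at this

lemma E_ne_bot (hr : IsProbVector r) (η : FinPath D) : E r η ≠ ⊥ := by
  intro h
  obtain ⟨v, hv⟩ := hr.exists_ne ⟨0, by have := hr.two_le; omega⟩
  have hmem : toL2Lin r (haarFun r η v _) ∈ E r η := Submodule.subset_span ⟨v, _, hv, rfl⟩
  rw [h, Submodule.mem_bot] at hmem
  have := inner_chi_haarFun_self hr η hv
  rw [hmem, inner_zero_right] at this
  exact zero_ne_one this

lemma E_le_opEigenspace (hr : IsProbVector r) (s : ℝ) (η : FinPath D) :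
    E r η ≤ opEigenspace (laplaceBeltrami r s) ((eigval r s η : ℝ) : ℂ) := by
  rw [opEigenspace_laplaceBeltrami_ne_zero hr s
    (Complex.ofReal_ne_zero.2 (eigval_neg hr s η).ne)]
  exact (le_iSup (fun ξ : {ξ : FinPath D // ((eigval r s ξ : ℝ) : ℂ) = (eigval r s η : ℝ)} =>
    E r ξ.1) ⟨η, rfl⟩).trans (Submodule.le_topologicalClosure _)

end CuntzLaplace

end

theorem mainTheorem6 (D : ℕ) (hD : 2 ≤ D) (r : Fin D → ℝ) (hr : ∀ i, 0 < r i)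
    (hsum : ∑ i, r i = 1) (s : ℝ) :
    -- `0` is an eigenvalue, with eigenspace the constant functions
    CuntzLaplace.chi r [] ≠ 0 ∧
    CuntzLaplace.opEigenspace (CuntzLaplace.laplaceBeltrami r s) 0
      = Submodule.span ℂ {CuntzLaplace.chi r []} ∧
    -- the value at the empty path
    CuntzLaplace.eigval r s [] = -(CuntzLaplace.G r s [])⁻¹ ∧
    -- for each path `η`, the number `λ_η` is an eigenvalue, with eigenfunctions `E_η`
    (∀ η : CuntzLaplace.FinPath D, CuntzLaplace.E r η ≠ ⊥ ∧
      CuntzLaplace.E r η ≤ CuntzLaplace.opEigenspace (CuntzLaplace.laplaceBeltrami r s)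
        ((CuntzLaplace.eigval r s η : ℝ) : ℂ)) ∧
    -- there are no other eigenvalues
    (∀ c : ℂ, CuntzLaplace.opEigenspace (CuntzLaplace.laplaceBeltrami r s) c ≠ ⊥ ↔
      c = 0 ∨ ∃ η : CuntzLaplace.FinPath D, c = ((CuntzLaplace.eigval r s η : ℝ) : ℂ)) ∧
    -- every other eigenspace is the closed span of the `E_η` with that eigenvalue
    (∀ c : ℂ, c ≠ 0 → CuntzLaplace.opEigenspace (CuntzLaplace.laplaceBeltrami r s) c
      = (⨆ η : {η : CuntzLaplace.FinPath D // ((CuntzLaplace.eigval r s η : ℝ) : ℂ) = c},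
          CuntzLaplace.E r η.1).topologicalClosure) ∧
    -- the constants and the `E_η` form an orthogonal decomposition of `L²`
    (∀ η : CuntzLaplace.FinPath D,
      Submodule.span ℂ {CuntzLaplace.chi r []} ⟂ CuntzLaplace.E r η) ∧
    (∀ η η' : CuntzLaplace.FinPath D, η ≠ η' → CuntzLaplace.E r η ⟂ CuntzLaplace.E r η') ∧
    (Submodule.span ℂ {CuntzLaplace.chi r []} ⊔
      ⨆ η : CuntzLaplace.FinPath D, CuntzLaplace.E r η).topologicalClosure = ⊤ := by
  have h : CuntzLaplace.IsProbVector r := ⟨hD, hr, hsum⟩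
  refine ⟨CuntzLaplace.chi_nil_ne_zero h, CuntzLaplace.opEigenspace_laplaceBeltrami_zero h s, ?_,
    fun η => ⟨CuntzLaplace.E_ne_bot h η, CuntzLaplace.E_le_opEigenspace h s η⟩,
    fun c => ⟨fun hc => ?_, ?_⟩,
    fun c hc => CuntzLaplace.opEigenspace_laplaceBeltrami_ne_zero h s hc, fun η => ?_,
    fun η η' hne => ?_, ?_⟩
  · rw [CuntzLaplace.eigval, h.measureReal_cyl, CuntzLaplace.weight_nil]
    simp
  · by_contra! hne
    refine hc ?_
    rw [CuntzLaplace.opEigenspace_laplaceBeltrami_ne_zero h s hne.1]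
    -- For `c` not on the list the eigenspace is the closed span of an empty family.
    have : IsEmpty {η : CuntzLaplace.FinPath D //
        ((CuntzLaplace.eigval r s η : ℝ) : ℂ) = c} := ⟨fun η => hne.2 η.1 η.2.symm⟩
    rw [iSup_of_empty]
    exact (Submodule.closed_of_finiteDimensional _).submodule_topologicalClosure_eq
  · rintro (rfl | ⟨η, rfl⟩)
    · rw [CuntzLaplace.opEigenspace_laplaceBeltrami_zero h s, Ne, Submodule.span_singleton_eq_bot]
      exact CuntzLaplace.chi_nil_ne_zero h
    · exact ne_bot_of_le_ne_bot (CuntzLaplace.E_ne_bot h η) (CuntzLaplace.E_le_opEigenspace h s η)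
  · rw [← CuntzLaplace.map_haarSpace_none, ← CuntzLaplace.map_haarSpace_some]
    exact CuntzLaplace.isOrtho_map_haarSpace h _ _ (by simp)
  · rw [← CuntzLaplace.map_haarSpace_some, ← CuntzLaplace.map_haarSpace_some]
    exact CuntzLaplace.isOrtho_map_haarSpace h _ _ (by simpa using hne)
  · rw [← CuntzLaplace.dense_iSup_map_haarSpace h, iSup_option, CuntzLaplace.map_haarSpace_none]
    simp only [CuntzLaplace.map_haarSpace_some]
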